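/- Let $C$ be a non-trivial finite group. For a finitely generated group $\Gamma$, let $\Lambda_\Gamma$ be the set of finite index subgroups of $\Gamma$, directed by reverse inclusion, and set $$\widetilde{V_C}(\Gamma)=\varlimsup_{H\in\Lambda_\Gamma}\frac{\frac{1}{\log|C|}\log|\mathrm{Hom}(H,C)|-1}{[\Gamma:H]}=\inf_{H\in\Lambda_\Gamma}\ \sup_{K\in\Lambda_\Gamma,\,K\le H}\frac{\frac{1}{\log|C|}\log|\mathrm{Hom}(K,C)|-1}{[\Gamma:K]}$$ if $\Gamma$ is infinite, and $\widetilde{V_C}(\Gamma)=-\frac{1}{|\Gamma|}$ if $\Gamma$ is finite; here $\mathrm{Hom}(H,C)$ is the set of group homomorphisms from $H$ to $C$. Let $G$ be the fundamental group (with respect to a maximal tree) of a finite, non-empty, connected graph of groups $(\mathcal G,Y)$ with finitely generated vertex groups $G_u$, $u\in VY$, and finite edge groups $G_e$, $e\in EY$, where $EY$ is the set of geometric (unoriented) edges of $Y$, so that each edge is counted once; loops and multiple edges are allowed. Assume that each vertex group is residually finite or virtually torsion free (that is, it has a finite index subgroup without non-trivial elements of finite order). Then $$\widetilde{V_C}(G)=\sum_{u\in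 VY}\widetilde{V_C}(G_u)+\sum_{e\in EY}\frac{1}{|G_e|}.$$ -/

import Mathlib

universe uV uE uG uF

/-- A graph of groups over a graph with vertex set `V` and set of geometric (unoriented) edges `E`;
loops and multiple edges are allowed. Every geometric edge occurs once in `E`, with an arbitrarily
chosen orientation from `src e` to `tgt e`. Every edge group comes with monomorphisms into the
vertex groups of the two end points. -/
structure GraphOfGroups (V : Type uV) (E : Type uE) where
  /-- initial vertex of an edge -/
  src : E → V
  /-- terminal vertex of an edge -/
  tgt : E → V
  /-- the vertex groups -/
  vertexGroup : V → Type uG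
  /-- the edge groups -/
  edgeGroup : E → Type uF
  [vertexGroupInst : ∀ v, Group (vertexGroup v)]
  [edgeGroupInst : ∀ e, Group (edgeGroup e)]
  /-- inclusion of an edge group into the group of the initial vertex -/
  srcHom : ∀ e, edgeGroup e →* vertexGroup (src e)
  /-- inclusion of an edge group into the group of the terminal vertex -/
  tgtHom : ∀ e, edgeGroup e →* vertexGroup (tgt e)
  srcHom_injective : ∀ e, Function.Injective (srcHom e)
  tgtHom_injective : ∀ e, Function.Injective (tgtHom e)

namespace GraphOfGroups

attribute [instance] GraphOfGroups.vertexGroupInst GraphOfGroups.edgeGroupInst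

variable {V : Type uV} {E : Type uE}

/-- Two vertices are joined by an (unoriented) path all of whose edges lie in `T`. -/
def Joined (𝒢 : GraphOfGroups.{uV, uE, uG, uF} V E) (T : Set E) : V → V → Prop :=
  Relation.EqvGen fun u v => ∃ e ∈ T, 𝒢.src e = u ∧ 𝒢.tgt e = v

/-- `T` is the edge set of a maximal (spanning) tree of the underlying graph: the subgraph with all
vertices and with edge set `T` is non-empty, connected, and without circuits (no edge of `T` joins
two vertices that are still joined after the removal of this edge). If there is such a `T`, the
underlying graph is non-empty and connected. -/
structure IsMaximalTree (𝒢 : GraphOfGroups.{uV, uE, uG, uF} V E) (T : Set E) : Prop where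
  nonempty : Nonempty V
  connected : ∀ u v, 𝒢.Joined T u v
  acyclic : ∀ e ∈ T, ¬ 𝒢.Joined (T \ {e}) (𝒢.src e) (𝒢.tgt e)

/-- The free product of all vertex groups and of the free group on the edges. -/
abbrev BigFreeProduct (𝒢 : GraphOfGroups.{uV, uE, uG, uF} V E) : Type _ :=
  Monoid.Coprod (Monoid.CoprodI 𝒢.vertexGroup) (FreeGroup E)

/-- A vertex group in the big free product. -/
def ofVertex (𝒢 : GraphOfGroups.{uV, uE, uG, uF} V E) (v : V) :
    𝒢.vertexGroup v →* 𝒢.BigFreeProduct :=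
  Monoid.Coprod.inl.comp Monoid.CoprodI.of

/-- The letter of an edge in the big free product. -/
def letter (𝒢 : GraphOfGroups.{uV, uE, uG, uF} V E) (e : E) : 𝒢.BigFreeProduct :=
  Monoid.Coprod.inr (FreeGroup.of e)

/-- The relators of the fundamental group: `t_e · a^{tgt} · t_e⁻¹ = a^{src}` for every edge `e` and
every `a` in its edge group, and `t_e = 1` for every edge `e` of `T`. -/
def relators (𝒢 : GraphOfGroups.{uV, uE, uG, uF} V E) (T : Set E) : Set 𝒢.BigFreeProduct :=
  {x | ∃ (e : E) (a : 𝒢.edgeGroup e),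
      x = 𝒢.letter e * 𝒢.ofVertex (𝒢.tgt e) (𝒢.tgtHom e a) * (𝒢.letter e)⁻¹ *
        (𝒢.ofVertex (𝒢.src e) (𝒢.srcHom e a))⁻¹} ∪
  {x | ∃ e ∈ T, x = 𝒢.letter e}

/-- The fundamental group `π₁(𝒢, Y, T)` of a graph of groups with respect to a maximal tree `T`. -/
def FundGroup (𝒢 : GraphOfGroups.{uV, uE, uG, uF} V E) (T : Set E) : Type _ :=
  𝒢.BigFreeProduct ⧸ Subgroup.normalClosure (𝒢.relators T)

instance (𝒢 : GraphOfGroups.{uV, uE, uG, uF} V E) (T : Set E) : Group (𝒢.FundGroup T) :=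
  inferInstanceAs (Group (𝒢.BigFreeProduct ⧸ Subgroup.normalClosure (𝒢.relators T)))

end GraphOfGroups

/-- Some subgroup of finite index has no non-trivial element of finite order. (`IsMulTorsionFree`
asks for unique roots, which is stronger for non-commutative groups.) -/
def IsVirtuallyTorsionFree (G : Type*) [Group G] : Prop :=
  ∃ H : Subgroup G, H.FiniteIndex ∧ ∀ g ∈ H, IsOfFinOrder g → g = 1

/-- `V_C(G)`, the upper limit of `(log |Hom(K, C)| / log |C| - 1) / [G : K]` over the finite index
subgroups `K` of `G`, directed by reverse inclusion, as an extended real number: the infimum over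
finite index subgroups `H` of the supremum over finite index subgroups `K` contained in `H`. -/
noncomputable def homVolume (C : Type*) [Group C] (G : Type*) [Group G] : EReal :=
  ⨅ (H : Subgroup G) (_ : H.FiniteIndex), ⨆ (K : Subgroup G) (_ : K.FiniteIndex) (_ : K ≤ H),
    (((1 / Real.log (Nat.card C) * Real.log (Nat.card (K →* C)) - 1) / K.index : ℝ) : EReal)

open Classical in
/-- The modified volume: `-1 / |G|` for finite `G`, and `V_C(G)` for infinite `G`. -/
noncomputable def modifiedHomVolume (C : Type*) [Group C] (G : Type*) [Group G] : EReal :=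
  if Finite G then ((-1 / Nat.card G : ℝ) : EReal) else homVolume C G

/-! Let a group act on a finite set `X`. The lifts of this action to the wreath product of `C` with
the symmetric group are `C`-valued cocycles. On an orbit, such a cocycle amounts to a homomorphism
from a stabilizer to `C` and |C|^(size - 1) free choices. So log_|C| of the number of lifts, minus
|X|, is the sum over the orbits of log_|C| |Hom(Stab, C)| - 1 (`exists_orbit_reps`). This
`liftExcess` is |X| times the index-weighted mean of the densities of the stabilizers, and it adds
up over a graph of groups.

Indeed, lifts on the vertex groups, together with an intertwiner for every edge, are the same as a
lift on the fundamental group and a gauge transformation trivial at a base vertex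
(`gauge_bijective`). Where an edge group acts freely, there are |C|^(|X|/|G_e|) intertwiners. Taking
logarithms gives the formula exactly for each such `X` (`liftExcess_fundGroup`).

For the upper bound, `exists_normal_comap_le` gives a finite index normal `M` that meets the edge
groups trivially and the vertex groups in prescribed finite index subgroups. The formula is applied
to the cosets of any finite index `K ≤ M`. For the lower bound, `exists_perm_stabilizers` builds an
`X` whose vertex stabilizers are conjugates of subgroups of large density. Some point stabilizer in
the fundamental group then has density at least the mean. -/

namespace GraphOfGroups

variable {V : Type uV} {E : Type uE} (𝒢 : GraphOfGroups.{uV, uE, uG, uF} V E)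

/-! ### Potentials on forests -/

section Tree

variable {𝒢}

theorem Joined.mono {S T : Set E} (h : S ⊆ T) {u v : V} (huv : 𝒢.Joined S u v) :
    𝒢.Joined T u v :=
  Relation.EqvGen.mono (fun _ _ ⟨e, he, h'⟩ => ⟨e, h he, h'⟩) _ _ huv

/-- On a forest every group valued function on the edges is the coboundary of a function on the
vertices. -/
theorem exists_potential {A : Type*} [Group A] (T : Set E) (hT : T.Finite)
    (hacyc : ∀ e ∈ T, ¬ 𝒢.Joined (T \ {e}) (𝒢.src e) (𝒢.tgt e)) (a : E → A) :
    ∃ g : V → A, ∀ e ∈ T, g (𝒢.src e) * (g (𝒢.tgt e))⁻¹ = a e := by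
  classical
  induction T, hT using Set.Finite.induction_on with
  | empty => exact ⟨fun _ => 1, by simp⟩
  | @insert e S heS _ ih =>
    obtain ⟨g, hg⟩ := ih fun e' he' h => hacyc e' (Set.mem_insert_of_mem _ he')
      (h.mono (Set.sdiff_subset_sdiff_left (Set.subset_insert _ _)))
    have hse : ¬ 𝒢.Joined S (𝒢.src e) (𝒢.tgt e) := by
      have := hacyc e (Set.mem_insert _ _)
      rwa [Set.insert_sdiff_self_of_notMem heS] at this
    -- Right multiplication by a constant on the component of `tgt e` keeps all values on `S`. The
    -- constant is chosen to give `a e` on the new edge, whose source lies outside this component.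
    refine ⟨fun v => if 𝒢.Joined S v (𝒢.tgt e) then
      g v * ((g (𝒢.tgt e))⁻¹ * (a e)⁻¹ * g (𝒢.src e)) else g v, ?_⟩
    rintro e' (rfl | he')
    · have : 𝒢.Joined S (𝒢.tgt e') (𝒢.tgt e') := Relation.EqvGen.refl _
      simp only [if_neg hse, if_pos this]
      group
    · have hj : 𝒢.Joined S (𝒢.src e') (𝒢.tgt e') := Relation.EqvGen.rel _ _ ⟨e', he', rfl, rfl⟩
      have hiff : 𝒢.Joined S (𝒢.src e') (𝒢.tgt e) ↔ 𝒢.Joined S (𝒢.tgt e') (𝒢.tgt e) :=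
        ⟨fun h => (hj.symm _ _).trans _ _ _ h, fun h => hj.trans _ _ _ h⟩
      by_cases h : 𝒢.Joined S (𝒢.tgt e') (𝒢.tgt e)
      · simp only [if_pos h, if_pos (hiff.2 h), ← hg e' he']
        group
      · simp only [if_neg h, if_neg (mt hiff.1 h), ← hg e' he']

end Tree

/-! ### Universal property of the fundamental group -/

section FundGroup

variable (T : Set E)

/-- The canonical homomorphism from a vertex group to the fundamental group. -/
def vertexHom (v : V) : 𝒢.vertexGroup v →* 𝒢.FundGroup T :=
  (QuotientGroup.mk' (Subgroup.normalClosure (𝒢.relators T))).comp (𝒢.ofVertex v)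

/-- The element of the fundamental group given by an edge. -/
def stable (e : E) : 𝒢.FundGroup T :=
  QuotientGroup.mk' (Subgroup.normalClosure (𝒢.relators T)) (𝒢.letter e)

theorem stable_eq_one {e : E} (he : e ∈ T) : 𝒢.stable T e = 1 :=
  (QuotientGroup.eq_one_iff _).2 (Subgroup.subset_normalClosure (Or.inr ⟨e, he, rfl⟩))

theorem stable_mul_vertexHom (e : E) (a : 𝒢.edgeGroup e) :
    𝒢.stable T e * 𝒢.vertexHom T _ (𝒢.tgtHom e a) =
      𝒢.vertexHom T _ (𝒢.srcHom e a) * 𝒢.stable T e := by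
  have h : QuotientGroup.mk' (Subgroup.normalClosure (𝒢.relators T))
      (𝒢.letter e * 𝒢.ofVertex (𝒢.tgt e) (𝒢.tgtHom e a) * (𝒢.letter e)⁻¹ *
        (𝒢.ofVertex (𝒢.src e) (𝒢.srcHom e a))⁻¹) = 1 :=
    (QuotientGroup.eq_one_iff _).2 (Subgroup.subset_normalClosure (Or.inl ⟨e, a, rfl⟩))
  rw [map_mul, map_mul, map_mul, map_inv, map_inv, mul_inv_eq_one, mul_inv_eq_iff_eq_mul] at h
  exact h

variable {T}

theorem fundGroup_hom_ext {W : Type*} [Group W] {f f' : 𝒢.FundGroup T →* W}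
    (hv : ∀ v, f.comp (𝒢.vertexHom T v) = f'.comp (𝒢.vertexHom T v))
    (he : ∀ e, f (𝒢.stable T e) = f' (𝒢.stable T e)) : f = f' := by
  apply QuotientGroup.monoidHom_ext
  apply Monoid.Coprod.hom_ext
  · exact Monoid.CoprodI.ext_hom _ _ hv
  · exact FreeGroup.ext_hom _ _ he

theorem exists_fundGroup_hom {W : Type*} [Group W] (σ : ∀ v, 𝒢.vertexGroup v →* W) (t : E → W)
    (ht : ∀ e a, t e * σ _ (𝒢.tgtHom e a) = σ _ (𝒢.srcHom e a) * t e) (hT : ∀ e ∈ T, t e = 1) :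
    ∃ f : 𝒢.FundGroup T →* W,
      (∀ v, f.comp (𝒢.vertexHom T v) = σ v) ∧ ∀ e, f (𝒢.stable T e) = t e := by
  let f₀ : 𝒢.BigFreeProduct →* W :=
    Monoid.Coprod.lift (Monoid.CoprodI.lift σ) (FreeGroup.lift t)
  have h1 : ∀ v x, f₀ (𝒢.ofVertex v x) = σ v x := fun v x => by
    simp [f₀, ofVertex]
  have h2 : ∀ e, f₀ (𝒢.letter e) = t e := fun e => by simp [f₀, letter]
  have hker : Subgroup.normalClosure (𝒢.relators T) ≤ f₀.ker := by
    refine Subgroup.normalClosure_le_normal ?_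
    rintro x (⟨e, a, rfl⟩ | ⟨e, he, rfl⟩)
    · simp only [SetLike.mem_coe, MonoidHom.mem_ker, map_mul, map_inv, h1, h2, ht]
      group
    · simp only [SetLike.mem_coe, MonoidHom.mem_ker, h2, hT e he]
  refine ⟨QuotientGroup.lift _ f₀ hker, fun v => ?_, fun e => h2 e⟩
  ext x
  exact h1 v x

end FundGroup

end GraphOfGroups

/-! ### Lifts of homomorphisms and gauge transformations -/

/-- The lifts of a homomorphism `β` along a homomorphism `p`. -/
abbrev HomLift {W P G : Type*} [Group W] [Group P] [Group G] (p : W →* P) (β : G →* P) : Type _ :=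
  {f : G →* W // p.comp f = β}

/-- Conjugation of a lift by an element of the kernel. -/
def HomLift.conj {W P G : Type*} [Group W] [Group P] [Group G] {p : W →* P} {β : G →* P}
    (g : p.ker) (f : HomLift p β) : HomLift p β :=
  ⟨(MulAut.conj (g : W)).toMonoidHom.comp f.1, by
    ext x
    have hg : p g = 1 := g.2
    simp [hg, ← f.2]⟩

@[simp]
theorem HomLift.conj_apply {W P G : Type*} [Group W] [Group P] [Group G] {p : W →* P} {β : G →* P}
    (g : p.ker) (f : HomLift p β) (x : G) : (f.conj g).1 x = g * f.1 x * (g : W)⁻¹ := rfl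

namespace GraphOfGroups

variable {V : Type uV} {E : Type uE} (𝒢 : GraphOfGroups.{uV, uE, uG, uF} V E) {T : Set E}

/-- The elements over a given element `τ` which conjugate one homomorphism into another. -/
abbrev _root_.Intertwiner {W P Q : Type*} [Group W] [Group P] [Group Q] (p : W →* P) (τ : P)
    (f₁ f₂ : Q →* W) : Type _ :=
  {t : W // p t = τ ∧ ∀ q, t * f₂ q = f₁ q * t}

/-- Lifts on the vertex groups and on the edges, without the condition on the edges of the maximal
tree. -/
abbrev LiftData {W P : Type*} [Group W] [Group P] (p : W →* P) (β : 𝒢.FundGroup T →* P) : Type _ :=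
  Σ σ : ∀ v, HomLift p (β.comp (𝒢.vertexHom T v)),
    ∀ e, Intertwiner p (β (𝒢.stable T e)) ((σ (𝒢.src e)).1.comp (𝒢.srcHom e))
      ((σ (𝒢.tgt e)).1.comp (𝒢.tgtHom e))

variable {𝒢} {W P : Type*} [Group W] [Group P] {p : W →* P} {β : 𝒢.FundGroup T →* P}

theorem LiftData.ext {c d : 𝒢.LiftData p β} (hσ : ∀ v x, (c.1 v).1 x = (d.1 v).1 x)
    (ht : ∀ e, (c.2 e).1 = (d.2 e).1) : c = d := by
  obtain ⟨c1, c2⟩ := c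
  obtain ⟨d1, d2⟩ := d
  obtain rfl : c1 = d1 := funext fun v => Subtype.ext (MonoidHom.ext (hσ v))
  congr
  exact funext fun e => Subtype.ext (ht e)

/-- Restriction of a lift, changed by a gauge transformation. -/
def gauge (f : HomLift p β) (g : V → p.ker) : 𝒢.LiftData p β :=
  ⟨fun v => HomLift.conj (g v) ⟨f.1.comp (𝒢.vertexHom T v), by rw [← MonoidHom.comp_assoc, f.2]⟩,
    fun e => ⟨g (𝒢.src e) * f.1 (𝒢.stable T e) * (g (𝒢.tgt e) : W)⁻¹, by
      have h1 : p (g (𝒢.src e)) = 1 := (g (𝒢.src e)).2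
      have h2 : p (g (𝒢.tgt e)) = 1 := (g (𝒢.tgt e)).2
      simp [h1, h2, ← f.2], fun q => by
      have := congrArg f.1 (𝒢.stable_mul_vertexHom T e q)
      rw [map_mul, map_mul] at this
      simp only [MonoidHom.comp_apply, HomLift.conj_apply]
      calc _ = g (𝒢.src e) * (f.1 (𝒢.stable T e) * f.1 (𝒢.vertexHom T _ (𝒢.tgtHom e q))) *
            (g (𝒢.tgt e) : W)⁻¹ := by group
        _ = _ := by rw [this]; group⟩⟩

/-- On tree edges the intertwiners lie in the kernel of `p`, so a potential with values there
trivializes them. The conjugated data satisfy all the relators. With `P` trivial this glues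
arbitrary actions of the vertex groups. -/
theorem gauge_surjective [Finite E] (hT : 𝒢.IsMaximalTree T) (v₀ : V) (d : 𝒢.LiftData p β) :
    ∃ (f : HomLift p β) (g : V → p.ker), g v₀ = 1 ∧ gauge f g = d := by
  obtain ⟨σ, t⟩ := d
  have hker : ∀ e ∈ T, (t e).1 ∈ p.ker := fun e he => by
    rw [MonoidHom.mem_ker, (t e).2.1, 𝒢.stable_eq_one T he, map_one]
  classical
  obtain ⟨g', hg'⟩ := exists_potential T T.toFinite hT.acyclic
    fun e => if he : e ∈ T then (⟨(t e).1, hker e he⟩ : p.ker) else 1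
  let g : V → p.ker := fun v => g' v * (g' v₀)⁻¹
  have hg : ∀ e ∈ T, (g (𝒢.src e) : W) * (g (𝒢.tgt e) : W)⁻¹ = (t e).1 := fun e he => by
    have := congrArg (fun a : p.ker => (a : W)) (hg' e he)
    simp only [dif_pos he] at this
    rw [← this]
    simp [g]
  have hp : ∀ v, p (g v) = 1 := fun v => (g v).2
  obtain ⟨f, hf, hf'⟩ := 𝒢.exists_fundGroup_hom (T := T)
    (fun v => (HomLift.conj (g v)⁻¹ (σ v)).1)
    (fun e => (g (𝒢.src e) : W)⁻¹ * (t e).1 * g (𝒢.tgt e)) (fun e a => by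
      have := (t e).2.2 a
      simp only [MonoidHom.comp_apply] at this
      simp only [HomLift.conj_apply, InvMemClass.coe_inv, inv_inv]
      calc _ = (g (𝒢.src e) : W)⁻¹ * ((t e).1 * (σ (𝒢.tgt e)).1 (𝒢.tgtHom e a)) *
            g (𝒢.tgt e) := by group
        _ = _ := by rw [this]; group) (fun e he => by rw [← hg e he]; group)
  refine ⟨⟨f, ?_⟩, g, by simp [g], ?_⟩
  · refine 𝒢.fundGroup_hom_ext (fun v => ?_) fun e => ?_
    · rw [MonoidHom.comp_assoc, hf]
      exact (HomLift.conj (g v)⁻¹ (σ v)).2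
    · simp [hf', hp, (t e).2.1]
  · refine LiftData.ext (fun v x => ?_) fun e => ?_
    · have := DFunLike.congr_fun (hf v) x
      simp only [gauge, HomLift.conj_apply]
      rw [this]
      simp only [HomLift.conj_apply, InvMemClass.coe_inv]
      group
    · simp only [gauge, hf']
      group

theorem gauge_injective (hT : 𝒢.IsMaximalTree T) (v₀ : V) {f f' : HomLift p β} {g g' : V → p.ker}
    (h₀ : g v₀ = g' v₀) (h : gauge f g = gauge f' g') : f = f' ∧ g = g' := by
  have hσ : ∀ v x, (g v : W) * f.1 (𝒢.vertexHom T v x) * (g v : W)⁻¹ =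
      g' v * f'.1 (𝒢.vertexHom T v x) * (g' v : W)⁻¹ := fun v x =>
    congrArg (fun d : 𝒢.LiftData p β => (d.1 v).1 x) h
  have ht : ∀ e, (g (𝒢.src e) : W) * f.1 (𝒢.stable T e) * (g (𝒢.tgt e) : W)⁻¹ =
      g' (𝒢.src e) * f'.1 (𝒢.stable T e) * (g' (𝒢.tgt e) : W)⁻¹ := fun e =>
    congrArg (fun d : 𝒢.LiftData p β => (d.2 e).1) h
  -- Stable letters of tree edges are trivial, so the discrepancy of the two gauges is constant
  -- along the tree; it is trivial at `v₀`.
  have hconst : ∀ u v, 𝒢.Joined T u v → (g' u)⁻¹ * g u = (g' v)⁻¹ * g v := by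
    intro u v huv
    induction huv with
    | rel u v huv =>
      obtain ⟨e, he, rfl, rfl⟩ := huv
      have := ht e
      rw [𝒢.stable_eq_one T he, map_one, map_one, mul_one, mul_one] at this
      apply Subtype.ext
      simp only [Subgroup.coe_mul, InvMemClass.coe_inv]
      rw [inv_mul_eq_iff_eq_mul, ← mul_assoc, ← this]
      group
    | refl => rfl
    | symm _ _ _ ih => exact ih.symm
    | trans _ _ _ _ _ ih ih' => exact ih.trans ih'
  have hg : g = g' := funext fun v => by
    have := hconst v v₀ (hT.connected v v₀)
    rw [h₀, inv_mul_cancel, inv_mul_eq_one] at this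
    exact this.symm
  subst hg
  refine ⟨Subtype.ext (𝒢.fundGroup_hom_ext (fun v => ?_) fun e => ?_), rfl⟩
  · ext x
    simpa using hσ v x
  · simpa using ht e

/-- Every system of lifts is determined by a lift on the fundamental group and a gauge
transformation which is trivial at the base point. -/
theorem gauge_bijective [Finite E] (hT : 𝒢.IsMaximalTree T) (v₀ : V) :
    Function.Bijective fun q : HomLift p β × {g : V → p.ker // g v₀ = 1} => gauge q.1 q.2.1 := by
  constructor
  · rintro ⟨f, g, hg⟩ ⟨f', g', hg'⟩ h
    obtain ⟨rfl, rfl⟩ := gauge_injective hT v₀ (hg.trans hg'.symm) h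
    rfl
  · intro d
    obtain ⟨f, g, hg, h⟩ := gauge_surjective hT v₀ d
    exact ⟨⟨f, g, hg⟩, h⟩

end GraphOfGroups

/-! ### Permutational wreath products -/

section Wreath

/-- The unrestricted permutational wreath product of a group with the symmetric group of a set. -/
abbrev PermWreath (C X : Type*) [Group C] : Type _ :=
  (X → C) ⋊[mulAutArrow (G := Equiv.Perm X) (A := X) (M := C)] Equiv.Perm X

namespace PermWreath

variable {C X G : Type*} [Group C] [Group G]

/-- The projection of a wreath product onto the symmetric group. -/
abbrev proj (C X : Type*) [Group C] : PermWreath C X →* Equiv.Perm X := SemidirectProduct.rightHom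

/-- The coordinate of an element of the wreath product at the image of a point. -/
def coord (w : PermWreath C X) (x : X) : C := w.left (w.right x)

theorem left_eq_coord (w : PermWreath C X) (x : X) : w.left x = w.coord (w.right⁻¹ x) := by
  simp [coord]

theorem ext_coord {w w' : PermWreath C X} (h : w.right = w'.right)
    (hc : ∀ x, w.coord x = w'.coord x) : w = w' := by
  refine SemidirectProduct.ext (funext fun x => ?_) h
  rw [left_eq_coord, left_eq_coord, hc, h]

/-- Indexing by the source point instead of its image turns multiplication into the cocycle rule, so
that lifts of an action become cocycles. -/
theorem coord_mul (w w' : PermWreath C X) (x : X) :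
    (w * w').coord x = w.coord (w'.right x) * w'.coord x := by
  simp only [coord, SemidirectProduct.mul_left, SemidirectProduct.mul_right, Pi.mul_apply,
    Equiv.Perm.mul_apply]
  congr 1
  change w'.left (w.right⁻¹ (w.right (w'.right x))) = _
  simp

@[simp]
theorem coord_one (x : X) : (1 : PermWreath C X).coord x = 1 := by
  simp [coord]

/-- The element of the wreath product with given coordinates. -/
def ofCoord (c : X → C) (σ : Equiv.Perm X) : PermWreath C X := ⟨fun x => c (σ⁻¹ x), σ⟩

@[simp]
theorem coord_ofCoord (c : X → C) (σ : Equiv.Perm X) (x : X) : (ofCoord c σ).coord x = c x := by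
  simp [ofCoord, coord]

@[simp]
theorem right_ofCoord (c : X → C) (σ : Equiv.Perm X) : (ofCoord c σ).right = σ := rfl

/-- The kernel of the projection onto the symmetric group. -/
def kerEquiv (C X : Type*) [Group C] : (proj C X).ker ≃ (X → C) where
  toFun w := w.1.left
  invFun a := ⟨⟨a, 1⟩, rfl⟩
  left_inv w := Subtype.ext (SemidirectProduct.ext rfl (Eq.symm w.2))
  right_inv _ := rfl

/-- The action of the wreath product on the product. -/
def toPermProd (X F : Type*) : PermWreath (Equiv.Perm F) X →* Equiv.Perm (X × F) where
  toFun w := ⟨fun y => (w.right y.1, w.coord y.1 y.2),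
    fun y => (w⁻¹.right y.1, w⁻¹.coord y.1 y.2), fun y => by
      have h := coord_mul w⁻¹ w y.1
      rw [inv_mul_cancel, coord_one] at h
      refine Prod.ext (by simp) ?_
      change (w⁻¹.coord (w.right y.1) * w.coord y.1) y.2 = _
      rw [← h]
      rfl, fun y => by
      have h := coord_mul w w⁻¹ y.1
      rw [mul_inv_cancel, coord_one] at h
      refine Prod.ext (by simp) ?_
      change (w.coord (w⁻¹.right y.1) * w⁻¹.coord y.1) y.2 = _
      rw [← h]
      rfl⟩
  map_one' := by
    ext y <;> simp
  map_mul' w w' := by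
    ext y <;> simp [coord_mul]

theorem toPermProd_apply {F : Type*} (w : PermWreath (Equiv.Perm F) X) (x : X) (y : F) :
    toPermProd X F w (x, y) = (w.right x, w.coord x y) := rfl

end PermWreath

end Wreath

/-! ### Orbit representatives and stabilizers -/

section Orbits

open MulAction

variable (G X : Type*) [Group G] [MulAction G X]

/-- A group element which moves the chosen representative of an orbit to a given point. -/
noncomputable def orbitMover (x : X) : G :=
  (orbitRel_apply.1 (Quotient.exact (Quotient.out_eq (Quotient.mk (orbitRel G X) x)).symm :
    orbitRel G X x (Quotient.mk (orbitRel G X) x).out)).choose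

variable {X}

theorem orbitMover_smul (x : X) :
    orbitMover G X x • (Quotient.mk (orbitRel G X) x).out = x :=
  (orbitRel_apply.1 (Quotient.exact (Quotient.out_eq (Quotient.mk (orbitRel G X) x)).symm :
    orbitRel G X x (Quotient.mk (orbitRel G X) x).out)).choose_spec

variable {G}

theorem orbitRel_mk_smul (g : G) (x : X) :
    Quotient.mk (orbitRel G X) (g • x) = Quotient.mk (orbitRel G X) x :=
  Quotient.sound (mem_orbit x g)

theorem card_eq_sum_index_stabilizer [Finite X] :
    let _ := Fintype.ofFinite (Quotient (orbitRel G X))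
    Nat.card X = ∑ ω : Quotient (orbitRel G X), (stabilizer G ω.out).index := by
  classical
  let _ := Fintype.ofFinite (Quotient (orbitRel G X))
  have : ∀ ω : Quotient (orbitRel G X), Finite (G ⧸ stabilizer G ω.out) := fun ω =>
    Finite.of_equiv _ (orbitEquivQuotientStabilizer G ω.out)
  rw [Nat.card_congr (selfEquivSigmaOrbitsQuotientStabilizer G X), Nat.card_sigma]
  rfl

end Orbits

/-! ### Counting lifts by homomorphisms on stabilizers -/

section Lifts

open MulAction PermWreath

variable {C G X : Type*} [Group C] [Group G] [MulAction G X]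

/-- The lifts of a permutation action to a wreath product. -/
abbrev WreathLift (C G X : Type*) [Group C] [Group G] [MulAction G X] : Type _ :=
  HomLift (proj C X) (toPermHom G X)

namespace WreathLift

theorem right_apply (f : WreathLift C G X) (g : G) (x : X) : (f.1 g).right x = g • x :=
  DFunLike.congr_fun (DFunLike.congr_fun f.2 g) x

theorem coord_mul (f : WreathLift C G X) (g h : G) (x : X) :
    (f.1 (g * h)).coord x = (f.1 g).coord (h • x) * (f.1 h).coord x := by
  rw [map_mul, PermWreath.coord_mul, right_apply]

theorem coord_one (f : WreathLift C G X) (x : X) : (f.1 1).coord x = 1 := by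
  rw [map_one, PermWreath.coord_one]

theorem ext {f f' : WreathLift C G X} (h : ∀ g x, (f.1 g).coord x = (f'.1 g).coord x) :
    f = f' := by
  refine Subtype.ext (MonoidHom.ext fun g => ext_coord (Equiv.ext fun x => ?_) (h g))
  rw [right_apply, right_apply]

/-- The lift given by a cocycle. -/
def ofCocycle (c : G → X → C) (hc : ∀ g h x, c (g * h) x = c g (h • x) * c h x) :
    WreathLift C G X :=
  ⟨MonoidHom.mk' (fun g => ofCoord (c g) (toPermHom G X g)) fun g h => by
      refine ext_coord (map_mul (toPermHom G X) g h) fun x => ?_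
      rw [PermWreath.coord_mul, coord_ofCoord, coord_ofCoord, coord_ofCoord, hc]
      rfl, rfl⟩

@[simp]
theorem coord_ofCocycle (c : G → X → C) (hc : ∀ g h x, c (g * h) x = c g (h • x) * c h x)
    (g : G) (x : X) : ((ofCocycle c hc).1 g).coord x = c g x :=
  coord_ofCoord _ _ _

/-- The homomorphism on the stabilizer of a point given by a lift. -/
def stabHom (f : WreathLift C G X) (x : X) : stabilizer G x →* C where
  toFun k := (f.1 (k : G)).coord x
  map_one' := f.coord_one x
  map_mul' k l := by
    rw [Subgroup.coe_mul, coord_mul, show (l : G) • x = x from l.2]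

/-- A lift together with a choice of elements on the orbits gives homomorphisms on the stabilizers
of representatives of the orbits and a function on the set. -/
noncomputable def toStab (q : WreathLift C G X × (Quotient (orbitRel G X) → C)) :
    (∀ ω : Quotient (orbitRel G X), stabilizer G ω.out →* C) × (X → C) :=
  ⟨fun ω => (MulAut.conj (q.2 ω)⁻¹).toMonoidHom.comp (q.1.stabHom ω.out),
    fun x => (q.1.1 (orbitMover G X x)).coord (Quotient.mk (orbitRel G X) x).out *
      q.2 (Quotient.mk (orbitRel G X) x)⟩

/-- A cocycle on an orbit is determined by its restriction to the stabilizer of the representative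
and its values on the movers. The factor `d` makes up for the mover of a representative being merely
some element of the stabilizer. -/
theorem toStab_injective : Function.Injective (toStab (C := C) (G := G) (X := X)) := by
  rintro ⟨f, d⟩ ⟨f', d'⟩ h
  have h1 : ∀ (ω : Quotient (orbitRel G X)) (k : stabilizer G ω.out),
      (d ω)⁻¹ * (f.1 (k : G)).coord ω.out * d ω =
        (d' ω)⁻¹ * (f'.1 (k : G)).coord ω.out * d' ω := fun ω k => by
    have := DFunLike.congr_fun (congrFun (congrArg Prod.fst h) ω) k
    simpa [toStab, stabHom] using this
  have h2 : ∀ x, (f.1 (orbitMover G X x)).coord (Quotient.mk (orbitRel G X) x).out *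
      d (Quotient.mk (orbitRel G X) x) =
      (f'.1 (orbitMover G X x)).coord (Quotient.mk (orbitRel G X) x).out *
      d' (Quotient.mk (orbitRel G X) x) := fun x => congrFun (congrArg Prod.snd h) x
  have h3 : ∀ (ω : Quotient (orbitRel G X)) (g : G),
      (f.1 g).coord ω.out * d ω = (f'.1 g).coord ω.out * d' ω := by
    intro ω g
    set x := g • ω.out with hx
    have hω : Quotient.mk (orbitRel G X) x = ω := by
      rw [hx, orbitRel_mk_smul, Quotient.out_eq]
    have hm := orbitMover_smul G x
    have h2' := h2 x
    rw [hω] at hm h2'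
    set m := orbitMover G X x
    have hk : m⁻¹ * g ∈ stabilizer G ω.out := by
      rw [mem_stabilizer_iff, mul_smul, ← hx, inv_smul_eq_iff, hm]
    have key : ∀ f : WreathLift C G X, (f.1 g).coord ω.out =
        (f.1 m).coord ω.out * (f.1 (m⁻¹ * g)).coord ω.out := fun f => by
      conv_lhs => rw [← mul_inv_cancel_left m g, coord_mul, show (m⁻¹ * g) • ω.out = ω.out from hk]
    have h1' := h1 ω ⟨_, hk⟩
    simp only at h1'
    rw [key f, key f']
    calc _ = ((f.1 m).coord ω.out * d ω) *
          ((d ω)⁻¹ * (f.1 (m⁻¹ * g)).coord ω.out * d ω) := by group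
      _ = _ := by rw [h1', h2']; group
  have hd : d = d' := funext fun ω => by
    have := h3 ω 1
    rwa [coord_one, coord_one, one_mul, one_mul] at this
  subst hd
  refine Prod.ext (WreathLift.ext fun g x => ?_) rfl
  have e1 := h3 (Quotient.mk (orbitRel G X) x) (g * orbitMover G X x)
  have e2 := h3 (Quotient.mk (orbitRel G X) x) (orbitMover G X x)
  simp only [mul_left_inj] at e1 e2
  rw [coord_mul, coord_mul, orbitMover_smul, e2, mul_left_inj] at e1
  exact e1

theorem toStab_surjective : Function.Surjective (toStab (C := C) (G := G) (X := X)) := by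
  classical
  rintro ⟨φ, b⟩
  let m : X → G := orbitMover G X
  let π : X → Quotient (orbitRel G X) := Quotient.mk _
  have hm : ∀ x, m x • (π x).out = x := orbitMover_smul G
  have hπ : ∀ (g : G) x, π (g • x) = π x := orbitRel_mk_smul
  -- The value 1 off the stabilizer is never used; it only makes `ψ` a function on all of `G`.
  let ψ : ∀ _ : Quotient (orbitRel G X), G → C := fun ω g =>
    if h : g ∈ stabilizer G ω.out then φ ω ⟨g, h⟩ else 1
  have hψ : ∀ ω (k l : G), k ∈ stabilizer G ω.out → l ∈ stabilizer G ω.out →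
      ψ ω (k * l) = ψ ω k * ψ ω l := fun ω k l hk hl => by
    simp only [ψ, dif_pos hk, dif_pos hl, dif_pos (mul_mem hk hl), ← map_mul]
    rfl
  have hs : ∀ (g : G) x, (m (g • x))⁻¹ * g * m x ∈ stabilizer G (π x).out := fun g x => by
    have := hm (g • x)
    rw [hπ] at this
    rw [mem_stabilizer_iff, mul_smul, mul_smul, hm, inv_smul_eq_iff, this]
  let f : WreathLift C G X := ofCocycle
    (fun g x => b (g • x) * ψ (π x) ((m (g • x))⁻¹ * g * m x) * (b x)⁻¹) fun g h x => by
      have h1 := hs g (h • x)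
      rw [hπ] at h1
      rw [hπ, mul_smul, show (m (g • h • x))⁻¹ * (g * h) * m x =
        (m (g • h • x))⁻¹ * g * m (h • x) * ((m (h • x))⁻¹ * h * m x) by group,
        hψ _ _ _ h1 (hs h x)]
      group
  have hf : ∀ g x, (f.1 g).coord x =
      b (g • x) * ψ (π x) ((m (g • x))⁻¹ * g * m x) * (b x)⁻¹ := fun g x => coord_ofCocycle _ _ _ _
  have hπo : ∀ ω : Quotient (orbitRel G X), π ω.out = ω := fun ω => Quotient.out_eq ω
  have hmo : ∀ ω : Quotient (orbitRel G X), m ω.out ∈ stabilizer G ω.out := fun ω => by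
    have := hm ω.out
    rwa [hπo] at this
  -- The second component is forced by the requirement that the point `ω.out` receive the value `b
  -- ω.out`.
  refine ⟨⟨f, fun ω => b ω.out * (ψ ω (m ω.out))⁻¹⟩, Prod.ext (funext fun ω => ?_)
    (funext fun x => ?_)⟩
  · ext k
    have hk : (k : G) • ω.out = ω.out := k.2
    have hmem := hmo ω
    have e : ψ ω ((m ω.out)⁻¹ * k * m ω.out) = (ψ ω (m ω.out))⁻¹ * φ ω k * ψ ω (m ω.out) := by
      rw [hψ _ _ _ (mul_mem (inv_mem hmem) k.2) hmem, hψ _ _ _ (inv_mem hmem) k.2]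
      have h1 : ψ ω (m ω.out)⁻¹ = (ψ ω (m ω.out))⁻¹ := by
        rw [eq_inv_iff_mul_eq_one, ← hψ _ _ _ (inv_mem hmem) hmem, inv_mul_cancel]
        simp only [ψ, dif_pos (one_mem (stabilizer G ω.out))]
        exact map_one _
      have h2 : ψ ω k = φ ω k := dif_pos k.2
      rw [h1, h2]
    simp only [toStab, stabHom, MonoidHom.comp_apply, MonoidHom.coe_mk, OneHom.coe_mk,
      MulEquiv.coe_toMonoidHom, MulAut.conj_apply, hf, hk, hπo, e]
    group
  · have e : π (π x).out = π x := hπo _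
    change (f.1 (m x)).coord (π x).out * (b (π x).out * (ψ (π x) (m (π x).out))⁻¹) = b x
    rw [hf, hm, e, inv_mul_cancel, one_mul]
    group

theorem card_mul_card_pow [Finite X] :
    let _ := Fintype.ofFinite (Quotient (orbitRel G X))
    Nat.card (WreathLift C G X) * Nat.card C ^ Nat.card (Quotient (orbitRel G X)) =
      (∏ ω : Quotient (orbitRel G X), Nat.card (stabilizer G ω.out →* C)) *
        Nat.card C ^ Nat.card X := by
  intro _
  have := Nat.card_congr (Equiv.ofBijective _
    ⟨toStab_injective (C := C) (G := G) (X := X), toStab_surjective⟩)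
  rwa [Nat.card_prod, Nat.card_prod, Nat.card_fun, Nat.card_fun, Nat.card_pi] at this

instance [Finite C] [Finite X] [hG : Group.FG G] : Finite (WreathLift C G X) := by
  obtain ⟨S, hS⟩ := Group.fg_def.1 hG
  refine Finite.of_injective (β := S → X → C) (fun f s x => (f.1 (s : G)).coord x)
    fun f f' h => Subtype.ext (MonoidHom.eq_of_eqOn_dense hS fun s hs => ?_)
  exact ext_coord (Equiv.ext fun x => by rw [right_apply, right_apply])
    (congrFun (congrFun h ⟨s, hs⟩))

theorem card_le [Finite C] [Finite X] {S : Set G} (hS : Subgroup.closure S = ⊤) (hfin : S.Finite) :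
    Nat.card (WreathLift C G X) ≤ Nat.card C ^ (Nat.card X * S.ncard) := by
  have : Finite S := hfin
  have := Nat.card_le_card_of_injective (β := S → X → C)
    (fun f : WreathLift C G X => fun s x => (f.1 (s : G)).coord x)
    fun f f' h => Subtype.ext (MonoidHom.eq_of_eqOn_dense hS fun s hs =>
      ext_coord (Equiv.ext fun x => by rw [right_apply, right_apply])
        (congrFun (congrFun h ⟨s, hs⟩)))
  rwa [Nat.card_fun, Nat.card_fun, ← pow_mul] at this

instance : Nonempty (WreathLift C G X) := ⟨ofCocycle (fun _ _ => 1) (by simp)⟩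

end WreathLift

end Lifts

/-! ### Intertwiners of free actions -/

section Intertwiner

open MulAction PermWreath

variable {C Q X : Type*} [Group C] [Group Q] [MulAction Q X]

theorem card_orbits_mul_card [Finite X] [Finite Q] (hfree : ∀ (q : Q) (x : X), q • x = x → q = 1) :
    Nat.card (Quotient (orbitRel Q X)) * Nat.card Q = Nat.card X := by
  let _ := Fintype.ofFinite (Quotient (orbitRel Q X))
  rw [card_eq_sum_index_stabilizer (G := Q) (X := X),
    Finset.sum_congr rfl (g := fun _ => Nat.card Q) fun ω _ => ?_]
  · simp [Nat.card_eq_fintype_card]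
  · rw [(Subgroup.eq_bot_iff_forall (stabilizer Q ω.out)).2 fun q hq => hfree q _ hq,
      Subgroup.index_bot]

namespace Intertwiner

variable {τ : Equiv.Perm X} {f₁ : Q →* PermWreath C X} {f₂ : WreathLift C Q X}

theorem coord_smul (t : Intertwiner (proj C X) τ f₁ f₂.1) (q : Q) (x : X) :
    t.1.coord (q • x) = (f₁ q).coord (τ x) * t.1.coord x * ((f₂.1 q).coord x)⁻¹ := by
  have h := congrArg (fun w => w.coord x) (t.2.2 q)
  have ht : t.1.right = τ := t.2.1
  simp only [PermWreath.coord_mul, f₂.right_apply, ht] at h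
  rw [← h, mul_inv_cancel_right]

/-- For free actions an intertwiner is determined by arbitrary values on representatives of the
orbits. -/
theorem bijective_coord_out (hfree : ∀ (q : Q) (x : X), q • x = x → q = 1)
    (hτ : ∀ (q : Q) (x : X), τ (q • x) = (f₁ q).right (τ x)) :
    Function.Bijective fun (t : Intertwiner (proj C X) τ f₁ f₂.1)
      (ω : Quotient (orbitRel Q X)) => t.1.coord ω.out := by
  constructor
  · intro t t' h
    refine Subtype.ext (ext_coord (t.2.1.trans t'.2.1.symm) fun x => ?_)
    have h' : t.1.coord (Quotient.mk (orbitRel Q X) x).out =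
        t'.1.coord (Quotient.mk (orbitRel Q X) x).out := congrFun h _
    rw [← orbitMover_smul Q x, coord_smul, coord_smul, h']
  · intro b
    let m : X → Q := orbitMover Q X
    let π : X → Quotient (orbitRel Q X) := Quotient.mk _
    have hm : ∀ x, m x • (π x).out = x := orbitMover_smul Q
    have hπ : ∀ (g : Q) x, π (g • x) = π x := orbitRel_mk_smul
    have hπo : ∀ ω : Quotient (orbitRel Q X), π ω.out = ω := fun ω => Quotient.out_eq ω
    -- Freeness makes the mover unique, hence equivariant, so values on representatives extend
    -- without any constraint.
    have huniq : ∀ (g : Q) x, m (g • x) = g * m x := fun g x => by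
      have h1 := hm (g • x)
      rw [hπ] at h1
      have := hfree ((m (g • x))⁻¹ * (g * m x)) (π x).out (by
        rw [mul_smul, mul_smul, hm, inv_smul_eq_iff, h1])
      rwa [inv_mul_eq_one] at this
    have hmo : ∀ ω : Quotient (orbitRel Q X), m ω.out = 1 := fun ω => by
      have := hm ω.out
      rw [hπo] at this
      exact hfree _ _ this
    let α : X → C := fun x => (f₁ (m x)).coord (τ (π x).out) * b (π x) *
      ((f₂.1 (m x)).coord (π x).out)⁻¹
    refine ⟨⟨ofCoord α τ, rfl, fun q => ext_coord (Equiv.ext fun x => ?_) fun x => ?_⟩,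
      funext fun ω => ?_⟩
    · change τ ((f₂.1 q).right x) = (f₁ q).right (τ x)
      rw [f₂.right_apply, hτ]
    · rw [PermWreath.coord_mul, PermWreath.coord_mul, coord_ofCoord, coord_ofCoord,
        right_ofCoord, f₂.right_apply]
      simp only [α, huniq, hπ, map_mul f₁, PermWreath.coord_mul, f₂.coord_mul, hm]
      rw [← hτ, hm]
      group
    · simp only [coord_ofCoord, α, hmo, hπo, map_one, PermWreath.coord_one]
      group

theorem card_eq [Finite X] (hfree : ∀ (q : Q) (x : X), q • x = x → q = 1)
    (hτ : ∀ (q : Q) (x : X), τ (q • x) = (f₁ q).right (τ x)) :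
    Nat.card (Intertwiner (proj C X) τ f₁ f₂.1) =
      Nat.card C ^ Nat.card (Quotient (orbitRel Q X)) := by
  rw [Nat.card_congr (Equiv.ofBijective _ (bijective_coord_out (f₁ := f₁) (f₂ := f₂) hfree hτ)),
    Nat.card_fun]

theorem nonempty_of_free (hfree : ∀ (q : Q) (x : X), q • x = x → q = 1)
    (hτ : ∀ (q : Q) (x : X), τ (q • x) = (f₁ q).right (τ x)) :
    Nonempty (Intertwiner (proj C X) τ f₁ f₂.1) :=
  ⟨((bijective_coord_out (f₁ := f₁) (f₂ := f₂) hfree hτ).2 1).choose⟩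

end Intertwiner

/-- Two free actions of a finite group on the same finite set are conjugate. -/
theorem exists_perm_conj_of_free {Q X : Type*} [Group Q] [Finite Q] [Finite X]
    (f₁ f₂ : Q →* Equiv.Perm X) (h₁ : ∀ q x, f₁ q x = x → q = 1)
    (h₂ : ∀ q x, f₂ q x = x → q = 1) :
    ∃ t : Equiv.Perm X, ∀ q, t * f₂ q = f₁ q * t := by
  -- Either action is isomorphic to |X|/|Q| copies of the left regular action.
  have key : ∀ (f : Q →* Equiv.Perm X), (∀ q x, f q x = x → q = 1) →
      ∃ e : X ≃ Fin (Nat.card X / Nat.card Q) × Q, ∀ q x, (e (f q x)) = ((e x).1, q * (e x).2) := by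
    intro f hf
    let _ : MulAction Q X := MulAction.compHom X f
    have hcard := card_orbits_mul_card (Q := Q) (X := X) hf
    let π : X → Quotient (orbitRel Q X) := Quotient.mk _
    let m : X → Q := orbitMover Q X
    have hm : ∀ x, m x • (π x).out = x := orbitMover_smul Q
    have hπ : ∀ (g : Q) x, π (g • x) = π x := orbitRel_mk_smul
    have huniq : ∀ (g : Q) x, m (g • x) = g * m x := fun g x => by
      have h1 := hm (g • x)
      rw [hπ] at h1
      have := hf ((m (g • x))⁻¹ * (g * m x)) (π x).out (by
        change ((m (g • x))⁻¹ * (g * m x)) • (π x).out = _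
        rw [mul_smul, mul_smul, hm, inv_smul_eq_iff, h1])
      rwa [inv_mul_eq_one] at this
    have hdiv : Nat.card (Quotient (orbitRel Q X)) = Nat.card X / Nat.card Q := by
      rw [← hcard, Nat.mul_div_cancel _ Nat.card_pos]
    let e₀ : Quotient (orbitRel Q X) ≃ Fin (Nat.card X / Nat.card Q) := Finite.equivFinOfCardEq hdiv
    let e₁ : X ≃ Fin (Nat.card X / Nat.card Q) × Q :=
      ⟨fun x => (e₀ (π x), m x), fun y => y.2 • (e₀.symm y.1).out, fun x => by simp [hm],
        fun y => by
          have hπo : π (e₀.symm y.1).out = e₀.symm y.1 := Quotient.out_eq _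
          have : m (e₀.symm y.1).out = 1 := by
            have := hm (e₀.symm y.1).out
            rw [hπo] at this
            exact hf _ _ this
          simp [hπ, huniq, hπo, this]⟩
    refine ⟨e₁, fun q x => ?_⟩
    change (e₀ (π (q • x)), m (q • x)) = _
    rw [hπ, huniq]
    rfl
  obtain ⟨e₁, he₁⟩ := key f₁ h₁
  obtain ⟨e₂, he₂⟩ := key f₂ h₂
  refine ⟨e₂.trans e₁.symm, fun q => Equiv.ext fun x => e₁.injective ?_⟩
  simp [he₁, he₂]

end Intertwiner

/-! ### The excess as a weighted mean of densities -/

section Excess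

open PermWreath

/-- The term `(log |Hom(K, C)| / log |C| - 1) / [G : K]` of the upper limit `homVolume`. -/
noncomputable def homDensity (C : Type*) [Group C] {G : Type*} [Group G] (K : Subgroup G) : ℝ :=
  (1 / Real.log (Nat.card C) * Real.log (Nat.card (K →* C)) - 1) / K.index

/-- The stabilizer of a point under a permutation representation. -/
def permStab {G X : Type*} [Group G] (ρ : G →* Equiv.Perm X) (x : X) : Subgroup G :=
  (MulAction.stabilizer (Equiv.Perm X) x).comap ρ

theorem mem_permStab {G X : Type*} [Group G] {ρ : G →* Equiv.Perm X} {x : X} {g : G} :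
    g ∈ permStab ρ x ↔ ρ g x = x := Iff.rfl

/-- The logarithmic number of lifts of a permutation representation on `X` to the wreath product
with `C`, minus the number of points. -/
noncomputable def liftExcess (C : Type*) [Group C] {G X : Type*} [Group G]
    (ρ : G →* Equiv.Perm X) : ℝ :=
  1 / Real.log (Nat.card C) * Real.log (Nat.card (HomLift (proj C X) ρ)) - Nat.card X

variable {C : Type*} [Group C] [Finite C] [Nontrivial C] {G X : Type*} [Group G] [Finite X]

theorem log_card_pos (C : Type*) [Finite C] [Nontrivial C] :
    0 < Real.log (Nat.card C) :=
  Real.log_pos (by exact_mod_cast Finite.one_lt_card)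

theorem exists_mulAction {G X : Type*} [Group G] (ρ : G →* Equiv.Perm X) :
    ∃ _ : MulAction G X, MulAction.toPermHom G X = ρ :=
  ⟨MulAction.compHom X ρ, MonoidHom.ext fun _ => Equiv.ext fun _ => rfl⟩

theorem finite_homLift {C : Type*} [Group C] [Finite C] (ρ : G →* Equiv.Perm X)
    (hG : Group.FG G) : Finite (HomLift (proj C X) ρ) := by
  obtain ⟨_, rfl⟩ := exists_mulAction ρ
  exact inferInstanceAs (Finite (WreathLift C G X))

instance instNonemptyHomLift {C : Type*} [Group C] {X : Type*} (ρ : G →* Equiv.Perm X) :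
    Nonempty (HomLift (proj C X) ρ) := by
  obtain ⟨_, rfl⟩ := exists_mulAction ρ
  exact inferInstanceAs (Nonempty (WreathLift C G X))

/-- This is the logarithm of `WreathLift.card_mul_card_pow`. Finiteness of the set of lifts is
assumed rather than finite generation, because for the fundamental group it comes out of the count
itself. -/
theorem exists_orbit_reps (ρ : G →* Equiv.Perm X) (hfin : Finite (HomLift (proj C X) ρ)) :
    ∃ s : Finset X, (∀ x, (permStab ρ x).index ≠ 0) ∧
      (Nat.card X : ℝ) = ∑ x ∈ s, ((permStab ρ x).index : ℝ) ∧
      liftExcess C ρ = ∑ x ∈ s, (permStab ρ x).index * homDensity C (permStab ρ x) := by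
  classical
  obtain ⟨_, rfl⟩ := exists_mulAction ρ
  set ρ := MulAction.toPermHom G X
  let _ := Fintype.ofFinite (Quotient (MulAction.orbitRel G X))
  have hinj : Function.Injective (fun ω : Quotient (MulAction.orbitRel G X) => ω.out) :=
    Quotient.out_injective
  have hindex : ∀ x : X, (permStab ρ x).index ≠ 0 := fun x => by
    have : Finite (G ⧸ MulAction.stabilizer G x) :=
      Finite.of_equiv _ (MulAction.orbitEquivQuotientStabilizer G x)
    exact (Subgroup.finiteIndex_of_finite_quotient (H := MulAction.stabilizer G x)).index_ne_zero
  have hX : Nat.card X = ∑ ω : Quotient (MulAction.orbitRel G X), (permStab ρ ω.out).index :=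
    card_eq_sum_index_stabilizer (G := G) (X := X)
  refine ⟨Finset.univ.image fun ω : Quotient (MulAction.orbitRel G X) => ω.out, hindex, ?_, ?_⟩
  · rw [Finset.sum_image hinj.injOn, hX]
    push_cast
    rfl
  · rw [Finset.sum_image hinj.injOn]
    have hcount := WreathLift.card_mul_card_pow (C := C) (G := G) (X := X)
    change Nat.card (HomLift (proj C X) ρ) * _ =
      (∏ ω : Quotient (MulAction.orbitRel G X), Nat.card (permStab ρ ω.out →* C)) * _ at hcount
    have hC : Nat.card C ≠ 0 := Nat.card_pos.ne'
    have hL : Nat.card (HomLift (proj C X) ρ) ≠ 0 := Nat.card_pos.ne'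
    -- The left side of the count is nonzero, so no factor on the right can be the default
    -- cardinality 0 of an infinite type.
    have hprod : ∀ ω : Quotient (MulAction.orbitRel G X), Nat.card (permStab ρ ω.out →* C) ≠ 0 := by
      have h0 := mul_ne_zero hL
        (pow_ne_zero (Nat.card (Quotient (MulAction.orbitRel G X))) hC)
      rw [hcount] at h0
      exact fun ω => Finset.prod_ne_zero_iff.1 (left_ne_zero_of_mul h0) ω (Finset.mem_univ _)
    have hlog := congrArg (fun n : ℕ => Real.log n) hcount
    simp only [Nat.cast_mul, Nat.cast_pow, Nat.cast_prod] at hlog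
    rw [Real.log_mul (by exact_mod_cast hL) (by positivity),
      Real.log_mul (Finset.prod_ne_zero_iff.2 fun ω _ => by exact_mod_cast hprod ω)
        (by positivity), Real.log_pow, Real.log_pow,
      Real.log_prod fun ω _ => by exact_mod_cast hprod ω] at hlog
    have hpos := log_card_pos C
    have hterm : ∀ ω : Quotient (MulAction.orbitRel G X),
        ((permStab ρ ω.out).index : ℝ) * homDensity C (permStab ρ ω.out) =
          1 / Real.log (Nat.card C) * Real.log (Nat.card (permStab ρ ω.out →* C)) - 1 := fun ω =>
      mul_div_cancel₀ _ (by exact_mod_cast hindex ω.out)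
    rw [Finset.sum_congr rfl fun ω _ => hterm ω, Finset.sum_sub_distrib, ← Finset.mul_sum,
      liftExcess]
    simp only [Finset.sum_const, Finset.card_univ, nsmul_eq_mul, mul_one]
    rw [Nat.card_eq_fintype_card (α := Quotient _)] at hlog
    field_simp
    linarith

theorem liftExcess_le {ρ : G →* Equiv.Perm X} (hfin : Finite (HomLift (proj C X) ρ)) {r : ℝ}
    (h : ∀ x, homDensity C (permStab ρ x) ≤ r) : liftExcess C ρ ≤ Nat.card X * r := by
  obtain ⟨s, -, h2, h3⟩ := exists_orbit_reps ρ hfin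
  rw [h3, h2, Finset.sum_mul]
  exact Finset.sum_le_sum fun x _ => mul_le_mul_of_nonneg_left (h x) (Nat.cast_nonneg _)

theorem le_liftExcess {ρ : G →* Equiv.Perm X} (hfin : Finite (HomLift (proj C X) ρ)) {r : ℝ}
    (h : ∀ x, r ≤ homDensity C (permStab ρ x)) : Nat.card X * r ≤ liftExcess C ρ := by
  obtain ⟨s, -, h2, h3⟩ := exists_orbit_reps ρ hfin
  rw [h3, h2, Finset.sum_mul]
  exact Finset.sum_le_sum fun x _ => mul_le_mul_of_nonneg_left (h x) (Nat.cast_nonneg _)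

theorem exists_le_homDensity [Nonempty X] {ρ : G →* Equiv.Perm X}
    (hfin : Finite (HomLift (proj C X) ρ)) {r : ℝ} (h : Nat.card X * r ≤ liftExcess C ρ) :
    ∃ x, (permStab ρ x).index ≠ 0 ∧ r ≤ homDensity C (permStab ρ x) := by
  obtain ⟨s, h1, h2, h3⟩ := exists_orbit_reps ρ hfin
  rw [h3, h2, Finset.sum_mul] at h
  have hs : s.Nonempty := by
    rw [Finset.nonempty_iff_ne_empty]
    rintro rfl
    have : Nat.card X ≠ 0 := Nat.card_pos.ne'
    simp at h2
    omega
  obtain ⟨x, -, hx⟩ := Finset.exists_le_of_sum_le hs h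
  exact ⟨x, h1 x, le_of_mul_le_mul_left hx
    (Nat.cast_pos.2 (Nat.pos_of_ne_zero (h1 x)))⟩

end Excess

/-! ### Additivity of the excess over a graph of groups -/

namespace GraphOfGroups

open PermWreath

variable {V : Type uV} {E : Type uE}
  {𝒢 : GraphOfGroups.{uV, uE, uG, uF} V E} {T : Set E}
  {C : Type*} [Group C] {X : Type*}

theorem card_pointed_mul_card [Fintype V] {A : Type*} [Group A] (v₀ : V) :
    Nat.card {g : V → A // g v₀ = 1} * Nat.card A = Nat.card A ^ Nat.card V := by
  rw [← Nat.card_fun, ← Nat.card_prod]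
  exact Nat.card_congr
    { toFun := fun q v => q.1.1 v * q.2
      invFun := fun h => ⟨⟨fun v => h v * (h v₀)⁻¹, mul_inv_cancel _⟩, h v₀⟩
      left_inv := fun ⟨⟨g, hg⟩, a⟩ => by simp [hg]
      right_inv := fun h => by simp }

variable (ρ : 𝒢.FundGroup T →* Equiv.Perm X)

theorem intertwiner_compat (σ : ∀ v, HomLift (proj C X) (ρ.comp (𝒢.vertexHom T v))) (e : E)
    [MulAction (𝒢.edgeGroup e) X] (hact : MulAction.toPermHom (𝒢.edgeGroup e) X =
      (ρ.comp (𝒢.vertexHom T _)).comp (𝒢.tgtHom e)) (q : 𝒢.edgeGroup e) (x : X) :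
    ρ (𝒢.stable T e) (q • x) =
      (((σ (𝒢.src e)).1.comp (𝒢.srcHom e)) q).right (ρ (𝒢.stable T e) x) := by
  have h1 : q • x = ρ (𝒢.vertexHom T _ (𝒢.tgtHom e q)) x :=
    DFunLike.congr_fun (DFunLike.congr_fun hact q) x
  have h2 : (((σ (𝒢.src e)).1.comp (𝒢.srcHom e)) q).right =
      ρ (𝒢.vertexHom T _ (𝒢.srcHom e q)) := DFunLike.congr_fun (σ (𝒢.src e)).2 _
  rw [h1, h2, ← Equiv.Perm.mul_apply, ← Equiv.Perm.mul_apply, ← map_mul, ← map_mul,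
    stable_mul_vertexHom]

variable (hfree : ∀ e (q : 𝒢.edgeGroup e) (x : X), ρ (𝒢.vertexHom T _ (𝒢.tgtHom e q)) x = x → q = 1)

include hfree

theorem nonempty_intertwiner
    (σ : ∀ v, HomLift (proj C X) (ρ.comp (𝒢.vertexHom T v))) (e : E) :
    Nonempty (Intertwiner (proj C X) (ρ (𝒢.stable T e)) ((σ (𝒢.src e)).1.comp (𝒢.srcHom e))
      ((σ (𝒢.tgt e)).1.comp (𝒢.tgtHom e))) := by
  obtain ⟨_, hact⟩ := exists_mulAction ((ρ.comp (𝒢.vertexHom T _)).comp (𝒢.tgtHom e))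
  refine Intertwiner.nonempty_of_free (f₂ := ⟨(σ (𝒢.tgt e)).1.comp (𝒢.tgtHom e), ?_⟩) ?_ ?_
  · rw [hact, ← MonoidHom.comp_assoc, (σ (𝒢.tgt e)).2]
  · exact fun q x hx => hfree e q x ((DFunLike.congr_fun (DFunLike.congr_fun hact q) x).symm.trans hx)
  · exact intertwiner_compat ρ σ e hact

theorem card_intertwiner [Finite X] [∀ e, Finite (𝒢.edgeGroup e)]
    (σ : ∀ v, HomLift (proj C X) (ρ.comp (𝒢.vertexHom T v))) (e : E) :
    ∃ n, n * Nat.card (𝒢.edgeGroup e) = Nat.card X ∧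
    Nat.card (Intertwiner (proj C X) (ρ (𝒢.stable T e)) ((σ (𝒢.src e)).1.comp (𝒢.srcHom e))
      ((σ (𝒢.tgt e)).1.comp (𝒢.tgtHom e))) = Nat.card C ^ n := by
  obtain ⟨_, hact⟩ := exists_mulAction ((ρ.comp (𝒢.vertexHom T _)).comp (𝒢.tgtHom e))
  have hfree' : ∀ (q : 𝒢.edgeGroup e) (x : X), q • x = x → q = 1 := fun q x hx =>
    hfree e q x ((DFunLike.congr_fun (DFunLike.congr_fun hact q) x).symm.trans hx)
  refine ⟨_, card_orbits_mul_card hfree',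
    Intertwiner.card_eq (f₂ := ⟨(σ (𝒢.tgt e)).1.comp (𝒢.tgtHom e), ?_⟩) hfree' ?_⟩
  · rw [hact, ← MonoidHom.comp_assoc, (σ (𝒢.tgt e)).2]
  · exact intertwiner_compat ρ σ e hact

/-- Both sides of `gauge_bijective` are counted. The gauge group at one vertex has order |C|^|X|;
the base vertex contributes nothing, which is why this factor reappears once on the right. -/
theorem lifts_count [Fintype V] [Fintype E] [Finite X] (hT : 𝒢.IsMaximalTree T) [Finite C] [∀ e, Finite (𝒢.edgeGroup e)]
    (hfin : ∀ v, Finite (HomLift (proj C X) (ρ.comp (𝒢.vertexHom T v)))) :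
    ∃ n : E → ℕ, (∀ e, n e * Nat.card (𝒢.edgeGroup e) = Nat.card X) ∧
      Finite (HomLift (proj C X) ρ) ∧
      Nat.card (HomLift (proj C X) ρ) * (Nat.card C ^ Nat.card X) ^ Fintype.card V =
        (∏ v, Nat.card (HomLift (proj C X) (ρ.comp (𝒢.vertexHom T v)))) *
          (∏ e, Nat.card C ^ n e) * Nat.card C ^ Nat.card X := by
  classical
  obtain ⟨v₀⟩ := hT.nonempty
  have hσ₀ : ∀ v, HomLift (proj C X) (ρ.comp (𝒢.vertexHom T v)) := fun v => Classical.arbitrary _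
  choose n hn _ using card_intertwiner ρ hfree hσ₀
  have hcard : ∀ (σ : ∀ v, HomLift (proj C X) (ρ.comp (𝒢.vertexHom T v))) e,
      Nat.card (Intertwiner (proj C X) (ρ (𝒢.stable T e)) ((σ (𝒢.src e)).1.comp (𝒢.srcHom e))
        ((σ (𝒢.tgt e)).1.comp (𝒢.tgtHom e))) = Nat.card C ^ n e := fun σ e => by
    obtain ⟨m, hm, h⟩ := card_intertwiner ρ hfree σ e
    rw [h, Nat.eq_of_mul_eq_mul_right Nat.card_pos (hm.trans (hn e).symm)]
  have hfinI : ∀ (σ : ∀ v, HomLift (proj C X) (ρ.comp (𝒢.vertexHom T v))) e,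
      Finite (Intertwiner (proj C X) (ρ (𝒢.stable T e)) ((σ (𝒢.src e)).1.comp (𝒢.srcHom e))
        ((σ (𝒢.tgt e)).1.comp (𝒢.tgtHom e))) := fun σ e =>
    Nat.finite_of_card_ne_zero (by rw [hcard]; exact pow_ne_zero _ Nat.card_pos.ne')
  have hbij := gauge_bijective (p := proj C X) (β := ρ) hT v₀
  have hker : Finite (proj C X).ker := Finite.of_equiv _ (kerEquiv C X).symm
  have hkercard : Nat.card (proj C X).ker = Nat.card C ^ Nat.card X := by
    rw [Nat.card_congr (kerEquiv C X), Nat.card_fun]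
  have hdata : Nat.card (𝒢.LiftData (proj C X) ρ) =
      (∏ v, Nat.card (HomLift (proj C X) (ρ.comp (𝒢.vertexHom T v)))) *
          (∏ e, Nat.card C ^ n e) := by
    let _ := Fintype.ofFinite (∀ v, HomLift (proj C X) (ρ.comp (𝒢.vertexHom T v)))
    rw [Nat.card_sigma]
    simp only [Nat.card_pi, hcard, Finset.sum_const, Finset.card_univ, smul_eq_mul]
    rw [← Nat.card_eq_fintype_card, Nat.card_pi]
  have hcount := Nat.card_congr (Equiv.ofBijective _ hbij)
  rw [Nat.card_prod, hdata] at hcount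
  refine ⟨n, hn, ?_, ?_⟩
  · have : Finite (HomLift (proj C X) ρ × {g : V → (proj C X).ker // g v₀ = 1}) :=
      Finite.of_equiv _ (Equiv.ofBijective _ hbij).symm
    exact Finite.of_surjective (fun q : HomLift (proj C X) ρ ×
      {g : V → (proj C X).ker // g v₀ = 1} => q.1) fun f => ⟨⟨f, ⟨fun _ => 1, rfl⟩⟩, rfl⟩
  · rw [← hcount, ← hkercard, mul_assoc, card_pointed_mul_card, Nat.card_eq_fintype_card (α := V)]

theorem liftExcess_fundGroup [Fintype V] [Fintype E] [Finite X] (hT : 𝒢.IsMaximalTree T) [Finite C] [Nontrivial C]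
    [∀ e, Finite (𝒢.edgeGroup e)]
    (hfin : ∀ v, Finite (HomLift (proj C X) (ρ.comp (𝒢.vertexHom T v)))) :
    Finite (HomLift (proj C X) ρ) ∧
    liftExcess C ρ = ∑ v, liftExcess C (ρ.comp (𝒢.vertexHom T v)) +
      Nat.card X * ∑ e, (1 / Nat.card (𝒢.edgeGroup e) : ℝ) := by
  obtain ⟨n, hn, hfinρ, hcount⟩ := lifts_count (C := C) ρ hfree hT hfin
  refine ⟨hfinρ, ?_⟩
  have hpos := log_card_pos C
  have hC : (Nat.card C : ℝ) ≠ 0 := by exact_mod_cast Nat.card_pos.ne'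
  have hL : (Nat.card (HomLift (proj C X) ρ) : ℝ) ≠ 0 := by exact_mod_cast Nat.card_pos.ne'
  have hLv : ∀ v, (Nat.card (HomLift (proj C X) (ρ.comp (𝒢.vertexHom T v))) : ℝ) ≠ 0 :=
    fun v => by exact_mod_cast Nat.card_pos.ne'
  have hlog := congrArg (fun n : ℕ => Real.log n) hcount
  simp only [Nat.cast_mul, Nat.cast_pow, Nat.cast_prod] at hlog
  rw [Real.log_mul hL (by positivity), Real.log_mul (mul_ne_zero (Finset.prod_ne_zero_iff.2
      fun v _ => hLv v) (Finset.prod_ne_zero_iff.2 fun e _ => by positivity)) (by positivity),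
    Real.log_mul (Finset.prod_ne_zero_iff.2 fun v _ => hLv v)
      (Finset.prod_ne_zero_iff.2 fun e _ => by positivity),
    Real.log_prod fun v _ => hLv v, Real.log_prod fun e _ => by positivity, Real.log_pow,
    Real.log_pow] at hlog
  simp only [Real.log_pow, ← Finset.sum_mul] at hlog
  have hne : ∀ e, (n e : ℝ) = Nat.card X * (1 / Nat.card (𝒢.edgeGroup e) : ℝ) := fun e => by
    have h0 : (Nat.card (𝒢.edgeGroup e) : ℝ) ≠ 0 := by exact_mod_cast Nat.card_pos.ne'
    rw [← hn e]
    push_cast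
    field_simp
  rw [Finset.mul_sum, ← Finset.sum_congr rfl fun e _ => hne e]
  simp only [liftExcess, Finset.sum_sub_distrib, ← Finset.mul_sum, Finset.sum_const,
    Finset.card_univ, nsmul_eq_mul]
  field_simp
  linarith

end GraphOfGroups

/-! ### Conjugation invariance and products of coset spaces -/

section Conjugation

theorem homDensity_map_equiv {C G : Type*} [Group C] [Group G] (f : G ≃* G)
    (K : Subgroup G) : homDensity C (K.map f.toMonoidHom) = homDensity C K := by
  have h1 : Nat.card (K.map f.toMonoidHom →* C) = Nat.card (K →* C) :=
    Nat.card_congr ((f.subgroupMap K).symm.monoidHomCongrLeftEquiv)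
  have h2 : (K.map f.toMonoidHom).index = K.index := Subgroup.index_map_equiv K f
  rw [homDensity, homDensity, h1, h2]

theorem homDensity_eq_of_mem_iff {C G : Type*} [Group C] [Group G] {K K' : Subgroup G}
    (g : G) (h : ∀ k, k ∈ K' ↔ g⁻¹ * k * g ∈ K) : homDensity C K' = homDensity C K := by
  rw [← homDensity_map_equiv (MulAut.conj g) K]
  congr 1
  ext k
  rw [h, Subgroup.mem_map]
  constructor
  · exact fun hk => ⟨_, hk, by simp [mul_assoc]⟩
  · rintro ⟨l, hl, rfl⟩
    simpa [mul_assoc] using hl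

end Conjugation

section ProductAction

/-- The action of a factor on the corresponding coordinate of a product of coset spaces. -/
def coordAction {V : Type*} [DecidableEq V] (G : V → Type*) [∀ v, Group (G v)]
    (K : ∀ v, Subgroup (G v)) (v : V) : G v →* Equiv.Perm (∀ v, G v ⧸ K v) :=
  (MulAction.toPermHom (∀ v, G v) (∀ v, G v ⧸ K v)).comp (MonoidHom.mulSingle G v)

theorem coordAction_eq_iff {V : Type*} [DecidableEq V] {G : V → Type*} [∀ v, Group (G v)]
    {K : ∀ v, Subgroup (G v)} {v : V} {g : G v} {x : ∀ v, G v ⧸ K v} :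
    coordAction G K v g x = x ↔ g • x v = x v := by
  constructor
  · intro h
    have := congrFun h v
    simpa [coordAction] using this
  · intro h
    ext w
    by_cases hw : w = v
    · subst hw
      simpa [coordAction] using h
    · simp [coordAction, Pi.mulSingle_eq_of_ne hw]

theorem exists_conj_of_smul_quotient {G : Type*} [Group G] {K : Subgroup G} (x : G ⧸ K) :
    ∃ h : G, ∀ g : G, g • x = x ↔ h⁻¹ * g * h ∈ K := by
  induction x using QuotientGroup.induction_on with
  | H h =>
    refine ⟨h, fun g => ?_⟩
    rw [eq_comm, MulAction.Quotient.smul_mk, QuotientGroup.eq, smul_eq_mul, mul_assoc]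

theorem mem_of_smul_quotient {G : Type*} [Group G] {N : Subgroup G} [N.Normal] {x : G ⧸ N} {g : G}
    (h : g • x = x) : g ∈ N := by
  obtain ⟨k, hk⟩ := exists_conj_of_smul_quotient x
  have := (hk g).1 h
  rwa [mul_assoc, Subgroup.Normal.mem_comm_iff inferInstance, mul_assoc, mul_inv_cancel, mul_one]
    at this

theorem smul_quotient_eq_of_mem {G : Type*} [Group G] {N : Subgroup G} [N.Normal] (x : G ⧸ N)
    {g : G} (h : g ∈ N) : g • x = x := by
  obtain ⟨k, hk⟩ := exists_conj_of_smul_quotient x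
  exact (hk g).2 (Subgroup.Normal.conj_mem' inferInstance g h k)

end ProductAction

/-! ### Finite index subgroups avoiding the edge groups -/

section Separation

/-- The hypothesis on vertex groups enters only here. Elements of finite edge groups have finite
order, so a torsion free subgroup avoids them all at once; otherwise finitely many separating
subgroups are intersected. -/
theorem exists_finiteIndex_inter_trivial {G : Type*} [Group G]
    (hG : Group.ResiduallyFinite G ∨ IsVirtuallyTorsionFree G) {S : Set G} (hS : S.Finite)
    (hord : ∀ g ∈ S, IsOfFinOrder g) :
    ∃ N : Subgroup G, N.FiniteIndex ∧ ∀ g ∈ S, g ∈ N → g = 1 := by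
  rcases hG with hG | ⟨H, hH, h⟩
  · have key : ∀ g : G, ∃ N : Subgroup G, N.FiniteIndex ∧ (g ∈ N → g = 1) := fun g => by
      by_cases hg : g = 1
      · exact ⟨⊤, inferInstance, fun _ => hg⟩
      · obtain ⟨N, hN⟩ := Group.exists_finiteIndexNormalSubgroup_notMem g hg
        exact ⟨N.toSubgroup, inferInstance, fun h => absurd h hN⟩
    choose N hN hgN using key
    have := hS.to_subtype
    refine ⟨⨅ g : S, N g, Subgroup.finiteIndex_iInf fun g => hN g, fun g hg hmem => hgN g ?_⟩
    exact (Subgroup.mem_iInf.1 hmem) ⟨g, hg⟩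
  · exact ⟨H, hH, fun g hg hgH => h g hgH (hord g hg)⟩

end Separation

namespace GraphOfGroups

open PermWreath

variable {V : Type uV} {E : Type uE} [Finite E]
  {𝒢 : GraphOfGroups.{uV, uE, uG, uF} V E} {T : Set E}

theorem exists_normal_inter_edge_trivial [∀ e, Finite (𝒢.edgeGroup e)]
    (hvertex : ∀ u, Group.ResiduallyFinite (𝒢.vertexGroup u) ∨
      IsVirtuallyTorsionFree (𝒢.vertexGroup u))
    (H : ∀ u, Subgroup (𝒢.vertexGroup u)) (hH : ∀ u, (H u).FiniteIndex) :
    ∃ N : ∀ u, Subgroup (𝒢.vertexGroup u), (∀ u, (N u).Normal) ∧ (∀ u, (N u).FiniteIndex) ∧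
      (∀ u, N u ≤ H u) ∧ (∀ e q, 𝒢.srcHom e q ∈ N (𝒢.src e) → q = 1) ∧
      (∀ e q, 𝒢.tgtHom e q ∈ N (𝒢.tgt e) → q = 1) := by
  let R : Set (Σ v, 𝒢.vertexGroup v) :=
    Set.range (fun z : Σ e, 𝒢.edgeGroup e => ⟨_, 𝒢.srcHom z.1 z.2⟩) ∪
      Set.range (fun z : Σ e, 𝒢.edgeGroup e => ⟨_, 𝒢.tgtHom z.1 z.2⟩)
  have hR : R.Finite := (Set.finite_range _).union (Set.finite_range _)
  have hord : ∀ z ∈ R, IsOfFinOrder z.2 := by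
    rintro _ (⟨z, rfl⟩ | ⟨z, rfl⟩)
    · exact (𝒢.srcHom z.1).isOfFinOrder (isOfFinOrder_of_finite z.2)
    · exact (𝒢.tgtHom z.1).isOfFinOrder (isOfFinOrder_of_finite z.2)
  have key := fun u => exists_finiteIndex_inter_trivial (hvertex u)
    (S := Sigma.mk u ⁻¹' R) (hR.preimage sigma_mk_injective.injOn) fun g hg => hord _ hg
  choose N hN hNR using key
  refine ⟨fun u => (H u ⊓ N u).normalCore, fun u => inferInstance, fun u => inferInstance,
    fun u => (Subgroup.normalCore_le _).trans inf_le_left, fun e q hq => ?_, fun e q hq => ?_⟩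
  · have h := hNR _ (𝒢.srcHom e q) (Or.inl ⟨⟨e, q⟩, rfl⟩)
      ((Subgroup.normalCore_le _).trans inf_le_right hq)
    exact 𝒢.srcHom_injective e (h.trans (map_one _).symm)
  · have h := hNR _ (𝒢.tgtHom e q) (Or.inr ⟨⟨e, q⟩, rfl⟩)
      ((Subgroup.normalCore_le _).trans inf_le_right hq)
    exact 𝒢.tgtHom_injective e (h.trans (map_one _).symm)

/-- The finite index subgroups of the vertex groups are induced from the fundamental group. -/
theorem exists_normal_comap_le [Finite V] (hT : 𝒢.IsMaximalTree T) [∀ e, Finite (𝒢.edgeGroup e)]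
    (hvertex : ∀ u, Group.ResiduallyFinite (𝒢.vertexGroup u) ∨
      IsVirtuallyTorsionFree (𝒢.vertexGroup u))
    (H : ∀ u, Subgroup (𝒢.vertexGroup u)) (hH : ∀ u, (H u).FiniteIndex) :
    ∃ M : Subgroup (𝒢.FundGroup T), M.Normal ∧ M.FiniteIndex ∧
      (∀ v, M.comap (𝒢.vertexHom T v) ≤ H v) ∧
      ∀ e q, 𝒢.vertexHom T _ (𝒢.tgtHom e q) ∈ M → q = 1 := by
  classical
  obtain ⟨N, hN, hNf, hNH, hsrc, htgt⟩ := exists_normal_inter_edge_trivial hvertex H hH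
  obtain ⟨v₀⟩ := hT.nonempty
  have hfin : ∀ v, Finite (𝒢.vertexGroup v ⧸ N v) := fun v => inferInstance
  -- All vertex groups act on one finite product, each through its own coordinate. Both copies of
  -- every edge group act freely on it, so they are conjugate there.
  let σ := coordAction 𝒢.vertexGroup N
  have hσ : ∀ v g x, σ v g x = x → g ∈ N v := fun v g x h =>
    mem_of_smul_quotient (coordAction_eq_iff.1 h)
  have ht := fun e => exists_perm_conj_of_free ((σ (𝒢.src e)).comp (𝒢.srcHom e))
    ((σ (𝒢.tgt e)).comp (𝒢.tgtHom e)) (fun q x h => hsrc e q (hσ _ _ _ h))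
    (fun q x h => htgt e q (hσ _ _ _ h))
  choose t ht using ht
  -- Over the trivial group a lift is any homomorphism, so this yields an action of the fundamental
  -- group that restricts to conjugates of the `σ v`.
  obtain ⟨f, g, -, hfg⟩ := gauge_surjective (p := (1 : Equiv.Perm (∀ v, 𝒢.vertexGroup v ⧸ N v) →*
    Unit)) (β := (1 : 𝒢.FundGroup T →* Unit)) hT v₀
    ⟨fun v => ⟨σ v, rfl⟩, fun e => ⟨t e, rfl, ht e⟩⟩
  have hf : ∀ v x, f.1 (𝒢.vertexHom T v x) = 1 → x ∈ N v := fun v x hx => by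
    have h : (g v : Equiv.Perm _) * f.1 (𝒢.vertexHom T v x) * (g v : Equiv.Perm _)⁻¹ = σ v x :=
      congrArg (fun d : 𝒢.LiftData _ _ => (d.1 v).1 x) hfg
    rw [hx, mul_one, mul_inv_cancel] at h
    exact hσ v x (fun v => ((1 : 𝒢.vertexGroup v) : 𝒢.vertexGroup v ⧸ N v)) (by rw [← h]; rfl)
  refine ⟨f.1.ker, inferInstance, ?_, fun v x hx => hNH v (hf v x hx),
    fun e q hq => htgt e q (hf _ _ hq)⟩
  exact Subgroup.finiteIndex_ker f.1

end GraphOfGroups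

/-! ### Permutation representations with prescribed vertex stabilizers -/

section Induction

open MulAction PermWreath

/-- If all point stabilizers are equal to the subgroup `H`, an action of `H` on `F` induces an
action of the group on the product whose stabilizers are the conjugates of those in `H`. -/
theorem exists_wreathLift_stabilizer {G B F : Type*} [Group G] [MulAction G B] (H K : Subgroup G)
    [H.Normal] (hst : ∀ (b : B) (g : G), g • b = b ↔ g ∈ H) (hK : K ≤ H) (φ : H →* Equiv.Perm F)
    (hφ : ∀ y, ∃ h : H, ∀ k : H, φ k y = y ↔ h⁻¹ * k * h ∈ K.subgroupOf H) :
    ∃ f : WreathLift (Equiv.Perm F) G B, ∀ z : B × F, ∃ g : G, ∀ k : G,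
      toPermProd B F (f.1 k) z = z ↔ g⁻¹ * k * g ∈ K := by
  obtain ⟨⟨f, d⟩, hfd⟩ := WreathLift.toStab_surjective (C := Equiv.Perm F) (G := G) (X := B)
    ⟨fun ω => φ.comp (Subgroup.inclusion fun k hk => (hst ω.out k).1 hk), fun _ => 1⟩
  have hd : ∀ (ω : Quotient (orbitRel G B)) (k : G) (hk : k ∈ H),
      (f.1 k).coord ω.out = d ω * φ ⟨k, hk⟩ * (d ω)⁻¹ := fun ω k hk => by
    have h : (d ω)⁻¹ * (f.1 k).coord ω.out * (d ω)⁻¹⁻¹ = φ ⟨k, hk⟩ :=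
      DFunLike.congr_fun (congrFun (congrArg Prod.fst hfd) ω) ⟨k, (hst ω.out k).2 hk⟩
    rw [← h]
    group
  refine ⟨f, fun ⟨b, y⟩ => ?_⟩
  set ω := Quotient.mk (orbitRel G B) b
  set m := orbitMover G B b
  have hm : m • ω.out = b := orbitMover_smul G b
  set c := (f.1 m).coord ω.out
  obtain ⟨h, hh⟩ := hφ ((d ω)⁻¹ (c⁻¹ y))
  -- `m` carries the representative of the orbit to `b`, and `h` conjugates within the fibre over
  -- that representative.
  refine ⟨m * h, fun k => ?_⟩
  have hconj : ∀ k, k ∈ H ↔ m⁻¹ * k * m ∈ H := fun k => by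
    rw [mul_assoc, Subgroup.Normal.mem_comm_iff inferInstance, mul_assoc, mul_inv_cancel, mul_one]
  have e : (m * (h : G))⁻¹ * k * (m * h) = (h : G)⁻¹ * (m⁻¹ * k * m) * h := by group
  rw [e]
  by_cases hk : k ∈ H
  · have hl := (hconj k).1 hk
    have hcoord : (f.1 k).coord b = c * (d ω * φ ⟨_, hl⟩ * (d ω)⁻¹) * c⁻¹ := by
      rw [← hd ω _ hl, eq_mul_inv_iff_mul_eq, ← hm, ← f.coord_mul,
        show k * m = m * (m⁻¹ * k * m) by group, f.coord_mul, (hst _ _).2 hl]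
    have hh' := hh ⟨_, hl⟩
    rw [Subgroup.mem_subgroupOf] at hh'
    rw [toPermProd_apply, f.right_apply, (hst b k).2 hk, Prod.mk.injEq, hcoord]
    simp only [true_and]
    refine Iff.trans ?_ hh'
    simp only [Equiv.Perm.mul_apply]
    rw [← Equiv.Perm.eq_inv_iff_eq, ← Equiv.Perm.eq_inv_iff_eq]
  · refine iff_of_false (fun h' => hk ?_) fun h' => hk ?_
    · rw [toPermProd_apply, f.right_apply, Prod.mk.injEq] at h'
      exact (hst b k).1 h'.1
    · rw [hconj]
      have := hK h'
      rwa [mul_assoc, Subgroup.Normal.mem_comm_iff inferInstance, mul_assoc, mul_inv_cancel,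
        mul_one] at this

end Induction

namespace GraphOfGroups

open PermWreath

variable {V : Type uV} {E : Type uE} [Finite V] [Finite E]
  {𝒢 : GraphOfGroups.{uV, uE, uG, uF} V E} {T : Set E}

/-- Given a finite index normal subgroup `M` which meets the edge groups trivially and finite index
subgroups `K v` of the vertex groups in `M`, there is a finite permutation representation with
point stabilizers in `M` whose vertex stabilizers are conjugates of the `K v`. -/
theorem exists_perm_stabilizers (hT : 𝒢.IsMaximalTree T) (M : Subgroup (𝒢.FundGroup T))
    [M.Normal] [M.FiniteIndex] (hM : ∀ e q, 𝒢.vertexHom T _ (𝒢.tgtHom e q) ∈ M → q = 1)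
    (K : ∀ v, Subgroup (𝒢.vertexGroup v)) (hK : ∀ v, (K v).FiniteIndex)
    (hKM : ∀ v, K v ≤ M.comap (𝒢.vertexHom T v)) :
    ∃ (X : Type (max uE uG uV)) (_ : Finite X) (_ : Nonempty X) (ρ : 𝒢.FundGroup T →* Equiv.Perm X),
      (∀ x, permStab ρ x ≤ M) ∧
      ∀ v x, ∃ g, ∀ k, k ∈ permStab (ρ.comp (𝒢.vertexHom T v)) x ↔ g⁻¹ * k * g ∈ K v := by
  classical
  obtain ⟨v₀⟩ := hT.nonempty
  let B := 𝒢.FundGroup T ⧸ M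
  let H : ∀ v, Subgroup (𝒢.vertexGroup v) := fun v => M.comap (𝒢.vertexHom T v)
  let L : ∀ v, Subgroup (H v) := fun v => (K v).subgroupOf (H v)
  let F := ∀ v, H v ⧸ L v
  let ρB : 𝒢.FundGroup T →* Equiv.Perm B := MulAction.toPermHom _ _
  have hfix : ∀ (b : B) γ, ρB γ b = b ↔ γ ∈ M := fun b γ =>
    ⟨fun h => mem_of_smul_quotient h, fun h => smul_quotient_eq_of_mem b h⟩
  have hφ : ∀ v (y : F), ∃ h : H v, ∀ k : H v, coordAction (fun v => H v) L v k y = y ↔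
      h⁻¹ * k * h ∈ L v := fun v y => by
    obtain ⟨h, hh⟩ := exists_conj_of_smul_quotient (y v)
    exact ⟨h, fun k => coordAction_eq_iff.trans (hh k)⟩
  have hlift : ∀ v, ∃ f : HomLift (proj (Equiv.Perm F) B) (ρB.comp (𝒢.vertexHom T v)),
      ∀ z : B × F, ∃ g, ∀ k, toPermProd B F (f.1 k) z = z ↔ g⁻¹ * k * g ∈ K v := fun v => by
    obtain ⟨_, hact⟩ := exists_mulAction (ρB.comp (𝒢.vertexHom T v))
    rw [← hact]
    refine exists_wreathLift_stabilizer (H v) (K v) (fun b g => ?_) (hKM v) _ (hφ v)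
    refine Iff.trans ?_ (hfix b (𝒢.vertexHom T v g))
    rw [show g • b = ρB (𝒢.vertexHom T v g) b from
      DFunLike.congr_fun (DFunLike.congr_fun hact g) b]
  choose σ hσ using hlift
  -- Edge groups act freely on the cosets of `M`, so the induced actions can be matched along every
  -- edge over the fixed action on `B`.
  have hI := nonempty_intertwiner ρB (fun e q x h => hM e q ((hfix _ _).1 h)) σ
  obtain ⟨f, g, -, hfg⟩ := gauge_surjective hT v₀ ⟨σ, fun e => Classical.choice (hI e)⟩
  have hfin : ∀ v, Finite (H v ⧸ L v) := fun v => inferInstance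
  refine ⟨B × F, inferInstance, inferInstance, (toPermProd B F).comp f.1, fun z γ h => ?_,
    fun v z => ?_⟩
  · have h1 : (f.1 γ).right z.1 = z.1 := congrArg Prod.fst h
    have h2 : (f.1 γ).right = ρB γ := DFunLike.congr_fun f.2 γ
    rw [h2] at h1
    exact (hfix _ _).1 h1
  -- The action restricted to the vertex group is `σ v` conjugated by the gauge, so the point is
  -- moved by `g v`.
  · obtain ⟨a, ha⟩ := hσ v (toPermProd B F (g v) z)
    refine ⟨a, fun k => ?_⟩
    rw [← ha k, mem_permStab]
    have h : (g v : PermWreath _ _) * f.1 (𝒢.vertexHom T v k) * (g v : PermWreath _ _)⁻¹ =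
        (σ v).1 k := congrArg (fun d : 𝒢.LiftData _ _ => (d.1 v).1 k) hfg
    rw [← h, map_mul, map_mul, map_inv]
    simp

end GraphOfGroups

/-! ### Bounds on densities and real values of the volume -/

section Bounds

variable {C : Type*} [Group C] {G : Type*} [Group G]

theorem neg_one_le_homDensity [Finite C] [Nontrivial C] (K : Subgroup G) : -1 ≤ homDensity C K := by
  have hpos := log_card_pos C
  have h : 0 ≤ 1 / Real.log (Nat.card C) * Real.log (Nat.card (K →* C)) :=
    mul_nonneg (by positivity) (Real.log_natCast_nonneg _)
  rcases Nat.eq_zero_or_pos K.index with h0 | h0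
  -- For infinite index the quotient by 0 is 0.
  · simp [homDensity, h0]
  · have h1 : (1 : ℝ) ≤ K.index := by exact_mod_cast h0
    rw [homDensity, le_div_iff₀ (by linarith)]
    linarith

theorem permStab_quotient (K : Subgroup G) (x : G ⧸ K) :
    ∃ g : G, ∀ k, k ∈ permStab (MulAction.toPermHom G (G ⧸ K)) x ↔ g⁻¹ * k * g ∈ K :=
  exists_conj_of_smul_quotient x

theorem homDensity_permStab_quotient (C : Type*) [Group C] (K : Subgroup G) (x : G ⧸ K) :
    homDensity C (permStab (MulAction.toPermHom G (G ⧸ K)) x) = homDensity C K := by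
  obtain ⟨g, hg⟩ := permStab_quotient K x
  exact homDensity_eq_of_mem_iff g hg

theorem homDensity_eq_liftExcess [Finite C] [Nontrivial C] (K : Subgroup G) [K.FiniteIndex]
    (hfin : Finite (HomLift (PermWreath.proj C (G ⧸ K)) (MulAction.toPermHom G (G ⧸ K)))) :
    liftExcess C (MulAction.toPermHom G (G ⧸ K)) = Nat.card (G ⧸ K) * homDensity C K :=
  le_antisymm (liftExcess_le hfin fun x => (homDensity_permStab_quotient C K x).le)
    (le_liftExcess hfin fun x => (homDensity_permStab_quotient C K x).ge)

/-- A lift is determined by its coordinates on a generating set, so the number of generators bounds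
all densities. -/
theorem exists_homDensity_le [Finite C] [Nontrivial C] (hG : Group.FG G) :
    ∃ d : ℝ, ∀ K : Subgroup G, K.FiniteIndex → homDensity C K ≤ d := by
  obtain ⟨S, hS⟩ := Group.fg_def.1 hG
  refine ⟨(S : Set G).ncard, fun K hK => ?_⟩
  have hfin := finite_homLift (C := C) (MulAction.toPermHom G (G ⧸ K)) hG
  have h1 := homDensity_eq_liftExcess (C := C) K hfin
  have h2 : Nat.card (HomLift (PermWreath.proj C (G ⧸ K)) (MulAction.toPermHom G (G ⧸ K))) ≤
      Nat.card C ^ (Nat.card (G ⧸ K) * (S : Set G).ncard) :=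
    WreathLift.card_le (C := C) (X := G ⧸ K) hS S.finite_toSet
  have hpos := log_card_pos C
  have hX : (0 : ℝ) < Nat.card (G ⧸ K) := by exact_mod_cast Nat.card_pos
  have h3 : Real.log (Nat.card (HomLift (PermWreath.proj C (G ⧸ K))
      (MulAction.toPermHom G (G ⧸ K)))) ≤
      Nat.card (G ⧸ K) * (S : Set G).ncard * Real.log (Nat.card C) := by
    have := Real.log_le_log (by exact_mod_cast Nat.card_pos) (Nat.cast_le (α := ℝ).2 h2)
    rwa [Nat.cast_pow, Real.log_pow, Nat.cast_mul] at this
  have h4 : liftExcess C (MulAction.toPermHom G (G ⧸ K)) ≤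
      Nat.card (G ⧸ K) * (S : Set G).ncard := by
    have : 1 / Real.log (Nat.card C) * Real.log (Nat.card (HomLift (PermWreath.proj C (G ⧸ K))
        (MulAction.toPermHom G (G ⧸ K)))) ≤ Nat.card (G ⧸ K) * (S : Set G).ncard := by
      rw [one_div_mul_eq_div, div_le_iff₀ hpos]
      exact h3
    rw [liftExcess]
    linarith
  rw [h1] at h4
  exact le_of_mul_le_mul_left h4 hX

variable (C G) in
-- In a finite group the trivial subgroup is the last term of the directed set, and its density is
-- -1/|G|. This removes the case distinction.
theorem modifiedHomVolume_eq_homVolume : modifiedHomVolume C G = homVolume C G := by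
  rw [modifiedHomVolume]
  split_ifs with hG
  · have hbot : ((1 / Real.log (Nat.card C) * Real.log (Nat.card ((⊥ : Subgroup G) →* C)) - 1) /
        (⊥ : Subgroup G).index : ℝ) = -1 / Nat.card G := by
      have : Nat.card ((⊥ : Subgroup G) →* C) = 1 := Nat.card_unique
      rw [this, Subgroup.index_bot]
      simp
    rw [homVolume]
    apply le_antisymm
    · refine le_iInf₂ fun H hH => ?_
      rw [← hbot]
      exact le_iSup_of_le ⊥ (le_iSup_of_le inferInstance (le_iSup_of_le bot_le le_rfl))
    · refine iInf₂_le_of_le ⊥ inferInstance (iSup_le fun K => iSup₂_le fun hK hK' => ?_)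
      obtain rfl := le_bot_iff.1 hK'
      rw [hbot]
  · rfl

theorem homVolume_le {r : ℝ} (H : Subgroup G) (hH : H.FiniteIndex)
    (h : ∀ K ≤ H, K.FiniteIndex → homDensity C K ≤ r) : homVolume C G ≤ r :=
  iInf₂_le_of_le H hH (iSup_le fun K => iSup₂_le fun hK hK' => EReal.coe_le_coe_iff.2 (h K hK' hK))

theorem le_homVolume {r : ℝ}
    (h : ∀ H : Subgroup G, H.FiniteIndex → ∃ K ≤ H, K.FiniteIndex ∧ r ≤ homDensity C K) :
    r ≤ homVolume C G := by
  refine le_iInf₂ fun H hH => ?_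
  obtain ⟨K, hKH, hK, hr⟩ := h H hH
  exact le_iSup_of_le K (le_iSup_of_le hK (le_iSup_of_le hKH (EReal.coe_le_coe_iff.2 hr)))

theorem exists_homDensity_le_of_homVolume_lt {r : ℝ} (h : homVolume C G < r) :
    ∃ H : Subgroup G, H.FiniteIndex ∧ ∀ K ≤ H, K.FiniteIndex → homDensity C K ≤ r := by
  rw [homVolume] at h
  simp only [iInf_lt_iff] at h
  obtain ⟨H, hH, h⟩ := h
  refine ⟨H, hH, fun K hKH hK => EReal.coe_le_coe_iff.1 (le_trans ?_ h.le)⟩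
  exact le_iSup_of_le K (le_iSup_of_le hK (le_iSup_of_le hKH le_rfl))

theorem exists_le_homDensity_of_lt_homVolume {r : ℝ} (h : r < homVolume C G) (H : Subgroup G)
    (hH : H.FiniteIndex) : ∃ K ≤ H, K.FiniteIndex ∧ r ≤ homDensity C K := by
  have := h.trans_le (iInf₂_le H hH)
  simp only [lt_iSup_iff] at this
  obtain ⟨K, hK, hKH, hr⟩ := this
  exact ⟨K, hKH, hK, EReal.coe_le_coe_iff.1 hr.le⟩

theorem exists_real_eq_homVolume [Finite C] [Nontrivial C] (hG : Group.FG G) : ∃ r : ℝ, homVolume C G = r := by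
  obtain ⟨d, hd⟩ := exists_homDensity_le (C := C) hG
  have h1 : homVolume C G ≤ d := homVolume_le ⊤ inferInstance fun K _ hK => hd K hK
  have h2 : ((-1 : ℝ) : EReal) ≤ homVolume C G :=
    le_homVolume fun H hH => ⟨H, le_rfl, hH, neg_one_le_homDensity H⟩
  refine ⟨(homVolume C G).toReal, (EReal.coe_toReal ?_ ?_).symm⟩
  · exact (h1.trans_lt (EReal.coe_lt_top d)).ne
  · exact ((EReal.bot_lt_coe _).trans_le h2).ne'

end Bounds

/-! ### The two inequalities -/

namespace GraphOfGroups

variable {V : Type uV} {E : Type uE} [Fintype V] [Fintype E]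
  {𝒢 : GraphOfGroups.{uV, uE, uG, uF} V E} {T : Set E}
  {C : Type*} [Group C] [Finite C] [Nontrivial C]

/-- On the cosets of `K ≤ M` all stabilizers lie in the normal subgroup `M`. Hence edge groups act
freely, and vertex stabilizers are so small that their densities are at most `r v`. -/
theorem homVolume_fundGroup_le (hT : 𝒢.IsMaximalTree T)
    (hfg : ∀ u, Group.FG (𝒢.vertexGroup u))
    (hvertex : ∀ u, Group.ResiduallyFinite (𝒢.vertexGroup u) ∨
      IsVirtuallyTorsionFree (𝒢.vertexGroup u))
    [∀ e, Finite (𝒢.edgeGroup e)] (r : V → ℝ) (hr : ∀ v, homVolume C (𝒢.vertexGroup v) < r v) :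
    homVolume C (𝒢.FundGroup T) ≤
      ((∑ v, r v + ∑ e, (1 / Nat.card (𝒢.edgeGroup e) : ℝ) : ℝ) : EReal) := by
  choose H hH hHr using fun v => exists_homDensity_le_of_homVolume_lt (hr v)
  obtain ⟨M, hMn, hMf, hMH, hM⟩ := exists_normal_comap_le hT hvertex H hH
  refine homVolume_le M hMf fun K hKM hK => ?_
  set X := 𝒢.FundGroup T ⧸ K
  set ρ : 𝒢.FundGroup T →* Equiv.Perm X := MulAction.toPermHom _ _
  have hst : ∀ x, permStab ρ x ≤ M := fun x γ hγ => by
    obtain ⟨g, hg⟩ := permStab_quotient K x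
    have := hKM ((hg γ).1 hγ)
    rwa [mul_assoc, Subgroup.Normal.mem_comm_iff inferInstance, mul_assoc, mul_inv_cancel,
      mul_one] at this
  have hfin := fun v => finite_homLift (C := C) (ρ.comp (𝒢.vertexHom T v)) (hfg v)
  obtain ⟨hfinρ, hex⟩ := liftExcess_fundGroup (C := C) ρ
    (fun e q x hx => hM e q (hst x hx)) hT hfin
  rw [homDensity_eq_liftExcess K hfinρ] at hex
  have hX : (0 : ℝ) < Nat.card X := by exact_mod_cast Nat.card_pos
  refine le_of_mul_le_mul_left ?_ hX
  rw [hex, mul_add, Finset.mul_sum _ r]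
  refine add_le_add (Finset.sum_le_sum fun v _ => ?_) le_rfl
  refine liftExcess_le (hfin v) fun x => hHr v _ (fun k hk => hMH v (hst x hk)) ?_
  obtain ⟨_, h, -⟩ := exists_orbit_reps _ (hfin v)
  exact ⟨h x⟩

theorem le_homVolume_fundGroup (hT : 𝒢.IsMaximalTree T)
    (hfg : ∀ u, Group.FG (𝒢.vertexGroup u))
    (hvertex : ∀ u, Group.ResiduallyFinite (𝒢.vertexGroup u) ∨
      IsVirtuallyTorsionFree (𝒢.vertexGroup u))
    [∀ e, Finite (𝒢.edgeGroup e)] (r : V → ℝ) (hr : ∀ v, r v < homVolume C (𝒢.vertexGroup v)) :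
    ((∑ v, r v + ∑ e, (1 / Nat.card (𝒢.edgeGroup e) : ℝ) : ℝ) : EReal) ≤
      homVolume C (𝒢.FundGroup T) := by
  refine le_homVolume fun H hH => ?_
  obtain ⟨M₀, hMn₀, hMf₀, -, hM₀⟩ := exists_normal_comap_le hT hvertex (fun _ => ⊤)
    fun _ => inferInstance
  let M := H.normalCore ⊓ M₀
  have hMf : M.FiniteIndex := inferInstance
  have hM : ∀ e q, 𝒢.vertexHom T _ (𝒢.tgtHom e q) ∈ M → q = 1 := fun e q hq => hM₀ e q hq.2
  choose K hKM hK hKr using fun v => exists_le_homDensity_of_lt_homVolume (hr v)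
    (M.comap (𝒢.vertexHom T v)) ⟨by
      rw [Subgroup.index_comap]
      have := Subgroup.isFiniteRelIndex_of_finiteIndex (H := M) (K := (𝒢.vertexHom T v).range)
      exact Subgroup.relIndex_ne_zero⟩
  obtain ⟨X, _, _, ρ, hst, hvst⟩ := exists_perm_stabilizers hT M hM K hK hKM
  have hfin := fun v => finite_homLift (C := C) (ρ.comp (𝒢.vertexHom T v)) (hfg v)
  obtain ⟨hfinρ, hex⟩ := liftExcess_fundGroup (C := C) ρ
    (fun e q x hx => hM e q (hst x hx)) hT hfin
  have hle : Nat.card X * (∑ v, r v + ∑ e, (1 / Nat.card (𝒢.edgeGroup e) : ℝ)) ≤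
      liftExcess C ρ := by
    rw [hex, mul_add, Finset.mul_sum]
    refine add_le_add (Finset.sum_le_sum fun v _ => ?_) le_rfl
    refine le_liftExcess (hfin v) fun x => ?_
    obtain ⟨g, hg⟩ := hvst v x
    rw [homDensity_eq_of_mem_iff g hg]
    exact hKr v
  -- The excess bounds a weighted mean of stabilizer densities from below, so one stabilizer attains
  -- the bound.
  obtain ⟨x, hx, hxr⟩ := exists_le_homDensity hfinρ hle
  exact ⟨permStab ρ x, (hst x).trans (inf_le_left.trans (Subgroup.normalCore_le H)), ⟨hx⟩, hxr⟩

end GraphOfGroups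

theorem ereal_coe_sum {ι : Type*} (s : Finset ι) (f : ι → ℝ) :
    ((∑ i ∈ s, f i : ℝ) : EReal) = ∑ i ∈ s, (f i : EReal) :=
  map_sum (⟨⟨Real.toEReal, EReal.coe_zero⟩, EReal.coe_add⟩ : ℝ →+ EReal) f s

theorem corollary3p11 {V : Type uV} {E : Type uE} [Fintype V] [Fintype E]
    (𝒢 : GraphOfGroups.{uV, uE, uG, uF} V E) (T : Set E) (hT : 𝒢.IsMaximalTree T)
    (hfg : ∀ u, Group.FG (𝒢.vertexGroup u))
    (hvertex : ∀ u, Group.ResiduallyFinite (𝒢.vertexGroup u) ∨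
      IsVirtuallyTorsionFree (𝒢.vertexGroup u))
    (hedge : ∀ e, Finite (𝒢.edgeGroup e))
    (C : Type*) [Group C] [Finite C] [Nontrivial C] :
    modifiedHomVolume C (𝒢.FundGroup T) =
      ∑ u, modifiedHomVolume C (𝒢.vertexGroup u) +
        ∑ e, ((1 / Nat.card (𝒢.edgeGroup e) : ℝ) : EReal) := by
  simp only [modifiedHomVolume_eq_homVolume]
  choose w hw using fun u => exists_real_eq_homVolume (C := C) (hfg u)
  have hV : 0 < (Fintype.card V : ℝ) := by
    have := hT.nonempty
    exact_mod_cast Fintype.card_pos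
  -- The two inequalities need strict bounds at each vertex, so the slack `c` is shared equally
  -- among the vertices.
  have hsum : ∀ c : ℝ, ∑ v, (w v + c / Fintype.card V) = ∑ v, w v + c := fun c => by
    rw [Finset.sum_add_distrib, Finset.sum_const, Finset.card_univ, nsmul_eq_mul,
      mul_div_cancel₀ _ hV.ne']
  set S : ℝ := ∑ e, (1 / Nat.card (𝒢.edgeGroup e) : ℝ) with hS
  have hgoal : ∑ u, homVolume C (𝒢.vertexGroup u) +
      ∑ e, ((1 / Nat.card (𝒢.edgeGroup e) : ℝ) : EReal) = ((∑ v, w v + S : ℝ) : EReal) := by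
    rw [EReal.coe_add, hS, ereal_coe_sum, ereal_coe_sum]
    simp only [hw]
  rw [hgoal]
  apply le_antisymm
  · refine EReal.le_of_forall_lt_iff_le.1 fun z hz => ?_
    have hz' : 0 < z - (∑ v, w v + S) := sub_pos.2 (EReal.coe_lt_coe_iff.1 hz)
    refine (GraphOfGroups.homVolume_fundGroup_le hT hfg hvertex
      (fun v => w v + (z - (∑ v, w v + S)) / Fintype.card V) fun v => ?_).trans ?_
    · rw [hw, EReal.coe_lt_coe_iff]
      have := div_pos hz' hV
      linarith
    · rw [hsum, EReal.coe_le_coe_iff]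
      linarith
  · refine EReal.ge_of_forall_gt_iff_ge.1 fun z hz => ?_
    have hz' : z - (∑ v, w v + S) < 0 := sub_neg.2 (EReal.coe_lt_coe_iff.1 hz)
    refine le_trans ?_ (GraphOfGroups.le_homVolume_fundGroup hT hfg hvertex
      (fun v => w v + (z - (∑ v, w v + S)) / Fintype.card V) fun v => ?_)
    · rw [hsum, EReal.coe_le_coe_iff]
      linarith
    · rw [hw, EReal.coe_lt_coe_iff]
      have := div_neg_of_neg_of_pos hz' hV
      linarith
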